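/- Let $d,\alpha\ge 1$ be integers and let $N$ be a prime. **Korobov space on the box.** For $a>0$ and $h\in\mathbb Z^d$ put $\varphi_{a,d,h}(x)=\prod_{j=1}^d\frac1{\sqrt{2a}}\exp\left(2\pi i h_j\frac{x_j+a}{2a}\right)$, $\widehat\phi_{a,d}(h)=\int_{[-a,a]^d}\phi\,\overline{\varphi_{a,d,h}}\,dx$ and $r_{\alpha,a,d}(h)=\prod_j r_{\alpha,a}(h_j)$, where $r_{\alpha,a}(0)=\sqrt{2a}$ and $r_{\alpha,a}(k)=|\pi k/a|^\alpha$ for $k\ne0$. The space $\mathcal H(K_{\alpha,a,d})$ consists of the (real- or complex-valued) functions $\phi$ on $[-a,a]^d$ that equal at every point the sum of their absolutely convergent Fourier series $\sum_h\widehat\phi_{a,d}(h)\varphi_{a,d,h}$ and satisfy $\|\phi\|_{K_{\alpha,a,d}}^2=\sum_h|\widehat\phi_{a,d}(h)|^2r_{\alpha,a,d}(h)^2<\infty$. **Lattice algorithm.** Put $r_{\alpha,d}(h)=\prod_j r_\alpha(h_j)$ with $r_\alpha(0)=1$ and $r_\alpha(k)=|2\pi k|^\alpha$ for $k\neq0$.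 For $z\in\{1,\dots,N-1\}^d$ put $$S(z)=\sum_{h\in\mathbb Z^d}\ \sum_{\substack{\ell\in\mathbb Z^d\setminus\{0\}\\ \ell\cdot z\equiv0\ (\mathrm{mod}\ N)}}\frac1{r_{\alpha,d}(h)^2\,r_{\alpha,d}(h+\ell)^2},$$ and for $1\le s\le d$ let $T_s(z_1,\dots,z_s)$ be the part of this sum with $\ell_s\neq0$ and $\ell_j=0$ for all $j>s$. A generating vector $z^*$ is produced by the component-by-component (CBC) construction if, for $s=1,\dots,d$ in turn, $z_s^*$ minimizes $c\mapsto T_s(z_1^*,\dots,z_{s-1}^*,c)$ over $\{1,\dots,N-1\}$. Let $y_k^*=\{kz^*/N\}$ (componentwise fractional part), $k=1,\dots,N$, $M=S(z^*)^{-1/2}$, and $$B_N^*(f)(y)=\sum_{h:\ r_{\alpha,d}(h)^2\le M}\Big(\frac1N\sum_{k=1}^N f(y_k^*)e^{-2\pi i\langle h,y_k^*\rangle}\Big)e^{2\pi i\langle h,y\rangle}.$$ With $\mathcal J_a(y)=2ay-(a,\dots,a)$, which maps $[0,1]^d$ onto $[-a,a]^d$, let $A_N^*(\phi)=B_N^*(\phi\circ\mathcal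 J_a)\circ\mathcal J_a^{-1}$. **Constant.** For $0<\delta<\alpha/2$ let $$C_{\alpha,\delta,d}=\sqrt2\,\max\left\{6,\ 2.5+2^{\frac{2\alpha}{\alpha-2\delta}+1}\right\}^{\alpha/2-\delta}\left(\sum_{u\subset\{1,\dots,d\}}\max(|u|,1)\left[2\left(\tfrac1{2\pi}\right)^{\frac{\alpha}{\alpha-2\delta}}\zeta\left(\tfrac{\alpha}{\alpha-2\delta}\right)\right]^{|u|}\right)^{\alpha-2\delta}.$$ **Proposition.** A vector $z^*$ produced by the CBC construction exists, and for every such $z^*$, every $a\ge\frac12$, every $\phi\in\mathcal H(K_{\alpha,a,d})$ and every $\delta\in(0,\alpha/2)$, $$\|\phi-A_N^*(\phi)\|_{L^2([-a,a]^d)}\le C_{\alpha,\delta',d}\,\|\phi\|_{K_{\alpha,a,d}}\,(2a)^{\alpha d}\,N^{-\alpha/2+\delta},\qquad \delta'=\min\left\{\delta,\tfrac\alpha2-\tfrac14\right\}.$$ In particular, for $\delta\le\frac\alpha2-\frac14$ the constant is $C_{\alpha,\delta,d}$ itself. -/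

import Mathlib

open MeasureTheory

noncomputable section

namespace Korobov

/-- The box `[-a,a]^d`. -/
def box (a : ℝ) (d : ℕ) : Set (Fin d → ℝ) := Set.Icc (fun _ => -a) (fun _ => a)

/-- The linear scaling `y ↦ 2a y - (a,…,a)`, which maps `[0,1]^d` onto `[-a,a]^d`. -/
def scaling (a : ℝ) {d : ℕ} (y : Fin d → ℝ) : Fin d → ℝ := fun j => 2 * a * y j - a

/-- The inverse of `scaling a` (for `a ≠ 0`). -/
def scalingInv (a : ℝ) {d : ℕ} (x : Fin d → ℝ) : Fin d → ℝ := fun j => (x j + a) / (2 * a)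

/-! ### The Korobov space on the box -/

/-- The scaled trigonometric functions, orthonormal in `L²([-a,a]^d)`. -/
def boxBasis (a : ℝ) {d : ℕ} (h : Fin d → ℤ) (x : Fin d → ℝ) : ℂ :=
  ∏ j, ((1 / Real.sqrt (2 * a) : ℝ) : ℂ) *
    Complex.exp (2 * Real.pi * Complex.I * (h j : ℂ) * (((x j + a) / (2 * a) : ℝ) : ℂ))

/-- The Fourier coefficients with respect to `boxBasis`. -/
def boxCoeff (a : ℝ) {d : ℕ} (φ : (Fin d → ℝ) → ℂ) (h : Fin d → ℤ) : ℂ :=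
  ∫ x in box a d, φ x * (starRingEnd ℂ) (boxBasis a h x)

/-- `∏ⱼ r(hⱼ)` with `r(0) = √(2a)` and `r(k) = |π k / a|^α` for `k ≠ 0`. -/
def boxWeight (α : ℕ) (a : ℝ) {d : ℕ} (h : Fin d → ℤ) : ℝ :=
  ∏ j, if h j = 0 then Real.sqrt (2 * a) else |Real.pi * (h j : ℝ) / a| ^ α

/-- Membership in the Korobov space of smoothness `α` on `[-a,a]^d`: on the whole (closed) box the
function is the sum of its (absolutely convergent) Fourier series, and its Korobov norm is finite.
Values outside the box play no role. -/
def MemKorobovBox (α : ℕ) (a : ℝ) {d : ℕ} (φ : (Fin d → ℝ) → ℂ) : Prop :=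
  (∀ x ∈ box a d, HasSum (fun h : Fin d → ℤ => boxCoeff a φ h * boxBasis a h x) (φ x)) ∧
    Summable (fun h : Fin d → ℤ => ‖boxCoeff a φ h‖ ^ 2 * boxWeight α a h ^ 2)

/-- The norm of the Korobov space on `[-a,a]^d`. -/
def korobovBoxNorm (α : ℕ) (a : ℝ) {d : ℕ} (φ : (Fin d → ℝ) → ℂ) : ℝ :=
  Real.sqrt (∑' h : Fin d → ℤ, ‖boxCoeff a φ h‖ ^ 2 * boxWeight α a h ^ 2)

/-! ### The lattice algorithm on the unit cube -/

/-- `∏ⱼ r(hⱼ)` with `r(0) = 1` and `r(k) = |2 π k|^α` for `k ≠ 0`: the square roots of the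
weights of the Fourier coefficients in the squared norm of the Korobov space on `[0,1]^d`. -/
def cubeWeight (α : ℕ) {d : ℕ} (h : Fin d → ℤ) : ℝ :=
  ∏ j, if h j = 0 then (1 : ℝ) else |2 * Real.pi * (h j : ℝ)| ^ α

/-- `ℓ · z ≡ 0 (mod N)`, that is, `ℓ` lies in the dual lattice of the generating vector `z`. -/
def InDual (N : ℕ) {d : ℕ} (z : Fin d → ℕ) (l : Fin d → ℤ) : Prop :=
  (N : ℤ) ∣ ∑ j, l j * (z j : ℤ)

/-- The quality criterion `S(z)` of a rank-1 lattice rule for `L²` approximation: the sum over all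
`h ∈ ℤ^d` and all nonzero `ℓ` in the dual lattice of `1 / (r(h)² r(h+ℓ)²)`. -/
def latticeCriterion (α N : ℕ) {d : ℕ} (z : Fin d → ℕ) : ℝ :=
  ∑' h : Fin d → ℤ, ∑' l : {l : Fin d → ℤ // l ≠ 0 ∧ InDual N z l},
    1 / (cubeWeight α h ^ 2 * cubeWeight α (h + l.1) ^ 2)

/-- The part `T_s(z)` of the criterion that collects the dual vectors whose last nonzero component
is the one with index `s`. It depends only on the components of `z` up to index `s`, and the sum
over `s` of these parts is `S(z)`. -/
def cbcCriterion (α N : ℕ) {d : ℕ} (s : Fin d) (z : Fin d → ℕ) : ℝ :=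
  ∑' h : Fin d → ℤ,
    ∑' l : {l : Fin d → ℤ // l s ≠ 0 ∧ (∀ j, s < j → l j = 0) ∧ InDual N z l},
      1 / (cubeWeight α h ^ 2 * cubeWeight α (h + l.1) ^ 2)

/-- `z` is an output of the component-by-component (CBC) construction: its components lie in
`{1,…,N-1}`, and each component in turn minimizes `T_s` over `{1,…,N-1}`, the earlier components
being fixed. (The later components do not enter into `T_s`.) -/
def IsCBC (α N : ℕ) {d : ℕ} (z : Fin d → ℕ) : Prop :=
  ∀ s : Fin d, z s ∈ Set.Icc 1 (N - 1) ∧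
    ∀ c ∈ Set.Icc 1 (N - 1), cbcCriterion α N s z ≤ cbcCriterion α N s (Function.update z s c)

/-- The lattice point `{k z / N}` (componentwise fractional part) in `[0,1)^d`. -/
def latticePoint (N : ℕ) {d : ℕ} (z : Fin d → ℕ) (k : ℕ) : Fin d → ℝ :=
  fun j => Int.fract ((k : ℝ) * (z j : ℝ) / (N : ℝ))

/-- `exp(2 π i ⟨h, y⟩)`. -/
def cubeBasis {d : ℕ} (h : Fin d → ℤ) (y : Fin d → ℝ) : ℂ :=
  Complex.exp (2 * Real.pi * Complex.I * ((∑ j, (h j : ℝ) * y j : ℝ) : ℂ))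

/-- The lattice rule approximation of the Fourier coefficient of `f` at `h`. -/
def latticeCoeff (N : ℕ) {d : ℕ} (z : Fin d → ℕ) (f : (Fin d → ℝ) → ℂ) (h : Fin d → ℤ) : ℂ :=
  (1 / (N : ℂ)) * ∑ k ∈ Finset.Icc 1 N,
    f (latticePoint N z k) * (starRingEnd ℂ) (cubeBasis h (latticePoint N z k))

/-- The index set `{h : r(h)² ≤ M}`. -/
def truncationSet (α : ℕ) (M : ℝ) (d : ℕ) : Set (Fin d → ℤ) := {h | cubeWeight α h ^ 2 ≤ M}

/-- The index set is finite, so that the sum in `latticeAlgorithm` is a finite sum. -/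
theorem truncationSet_finite (α : ℕ) (hα : 1 ≤ α) (M : ℝ) (d : ℕ) :
    (truncationSet α M d).Finite := by
  have hle : ∀ (k : ℤ), k ≠ 0 → |(k : ℝ)| ≤ |2 * Real.pi * (k : ℝ)| ^ α := by
    intro k hk
    have h1 : (1 : ℝ) ≤ |(k : ℝ)| := by
      have := Int.one_le_abs hk
      exact_mod_cast this
    have h2 : |(k : ℝ)| ≤ |2 * Real.pi * (k : ℝ)| := by
      rw [abs_mul, abs_of_pos (by positivity : (0 : ℝ) < 2 * Real.pi)]
      nlinarith [Real.pi_gt_three]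
    exact h2.trans (le_self_pow₀ (h1.trans h2) (by omega))
  have hone : ∀ (k : ℤ), (1 : ℝ) ≤ if k = 0 then (1 : ℝ) else |2 * Real.pi * (k : ℝ)| ^ α := by
    intro k
    split_ifs with hk
    · exact le_rfl
    · refine le_trans ?_ (hle k hk)
      have := Int.one_le_abs hk
      exact_mod_cast this
  refine (Set.finite_Icc (fun _ : Fin d => -⌈M⌉) (fun _ => ⌈M⌉)).subset ?_
  intro h hh
  have key : ∀ j, |h j| ≤ ⌈M⌉ := by
    intro j
    have hw : (if h j = 0 then (1 : ℝ) else |2 * Real.pi * (h j : ℝ)| ^ α) ≤ cubeWeight α h := by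
      unfold cubeWeight
      rw [← Finset.mul_prod_erase _ _ (Finset.mem_univ j)]
      refine le_mul_of_one_le_right (zero_le_one.trans (hone _)) ?_
      exact Finset.one_le_prod fun i _ => hone (h i)
    have hw1 : (1 : ℝ) ≤ cubeWeight α h := (hone (h j)).trans hw
    have hM : cubeWeight α h ≤ M := (le_self_pow₀ hw1 two_ne_zero).trans hh
    have habs : |(h j : ℝ)| ≤ M := by
      by_cases hj : h j = 0
      · rw [hj]; simp; linarith
      · rw [if_neg hj] at hw
        exact (hle _ hj).trans (hw.trans hM)
    have : ((|h j| : ℤ) : ℝ) ≤ (⌈M⌉ : ℝ) := by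
      push_cast
      exact habs.trans (Int.le_ceil M)
    exact_mod_cast this
  exact ⟨fun j => (abs_le.mp (key j)).1, fun j => (abs_le.mp (key j)).2⟩

/-- The lattice algorithm on `[0,1]^d`, with generating vector `z` and with truncation parameter
`M = 1/√S(z)`, the minimizer of the error bound `1/M + M S(z)`. -/
def latticeAlgorithm (α N : ℕ) {d : ℕ} (z : Fin d → ℕ) (f : (Fin d → ℝ) → ℂ)
    (y : Fin d → ℝ) : ℂ :=
  ∑ᶠ h ∈ truncationSet α (1 / Real.sqrt (latticeCriterion α N z)) d,
    latticeCoeff N z f h * cubeBasis h y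

/-- The scaled lattice algorithm on `[-a,a]^d`. -/
def scaledLatticeAlgorithm (α : ℕ) (a : ℝ) (N : ℕ) {d : ℕ} (z : Fin d → ℕ)
    (φ : (Fin d → ℝ) → ℂ) : (Fin d → ℝ) → ℂ :=
  latticeAlgorithm α N z (φ ∘ scaling a) ∘ scalingInv a

/-! ### The constant -/

/-- `ζ(s) = ∑_{n ≥ 1} n^{-s}` for real `s > 1`. -/
def realZeta (s : ℝ) : ℝ := ∑' n : ℕ, 1 / ((n : ℝ) + 1) ^ s

/-- The factor `κ_{α,δ}`. -/
def kappa (α : ℕ) (δ : ℝ) : ℝ :=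
  Real.sqrt 2 *
    (max 6 (5 / 2 + (2 : ℝ) ^ (2 * (α : ℝ) / ((α : ℝ) - 2 * δ) + 1))) ^ ((α : ℝ) / 2 - δ)

/-- The constant `C_{α,δ,d}`. -/
def errorConst (α : ℕ) (δ : ℝ) (d : ℕ) : ℝ :=
  kappa α δ *
    (∑ u : Finset (Fin d), ((max u.card 1 : ℕ) : ℝ) *
      (2 * (1 / (2 * Real.pi)) ^ ((α : ℝ) / ((α : ℝ) - 2 * δ)) *
        realZeta ((α : ℝ) / ((α : ℝ) - 2 * δ))) ^ u.card) ^ ((α : ℝ) - 2 * δ)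

end Korobov

end

/-!
Let `p = 1 / (4q)` with `q = α/2 - δ ≥ 1/4`, so that `p ≤ 1` and `β = 2αp > 1`. By Jensen's
inequality `T_s ^ p` is at most the same sum with the exponent `2α` replaced by `β`. A minimum over
`c` is at most the average over `c`, and since `N` is prime a vector `ℓ` with last nonzero component
`ℓ_s` lies in the dual lattice for at most one `c`, unless `N ∣ ℓ_s`. The sum over `h` is an
autocorrelation that factorizes over the coordinates; its values at the nonzero multiples of `N`
are smaller by a factor of order `N ^ (-β)`, since one of `h_s`, `h_s + ℓ_s` has absolute value at
least `|ℓ_s| / 2`. Altogether `T_s ^ p`, and hence `S ^ p`, is of order `1 / N`.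

The Fourier coefficients of the error are those of `φ` outside the truncation set and, up to sign,
the aliasing sums `∑ φ̂(h + ℓ)` over the nonzero dual vectors `ℓ` inside it. Parseval's identity and
the Cauchy–Schwarz inequality bound the squared error by `(1/M + M S) ‖φ‖² = 2 √S ‖φ‖²`.
-/

namespace Korobov

open scoped ComplexConjugate ENNReal

/-! ### Sums of extended nonnegative reals -/

theorem tsum_prod_apply {κ : Type*} {d : ℕ} (f : Fin d → κ → ℝ≥0∞) :
    ∑' h : Fin d → κ, ∏ j, f j (h j) = ∏ j, ∑' k, f j k := by
  induction d with
  | zero => simp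
  | succ d ih =>
    rw [← (Fin.consEquiv fun _ : Fin (d + 1) => κ).tsum_eq, ENNReal.tsum_prod', Fin.prod_univ_succ,
      ← ENNReal.tsum_mul_right]
    refine tsum_congr fun k => ?_
    rw [← ih, ← ENNReal.tsum_mul_left]
    refine tsum_congr fun h => ?_
    simp [Fin.prod_univ_succ, Fin.consEquiv]

theorem tsum_prod_mul_apply {κ : Type*} {d : ℕ} (f g : κ → ℝ≥0∞) (s : Fin d) :
    ∑' h : Fin d → κ, (∏ j, f (h j)) * g (h s) = (∑' k, f k) ^ (d - 1) * ∑' k, f k * g k := by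
  have hprod (h : Fin d → κ) :
      (∏ j, f (h j)) * g (h s) = ∏ j, f (h j) * if j = s then g (h j) else 1 := by
    rw [Finset.prod_mul_distrib, Fintype.prod_ite_eq']
  simp_rw [hprod]
  rw [tsum_prod_apply fun j k => f k * if j = s then g k else 1,
    ← Finset.prod_erase_mul _ _ (Finset.mem_univ s)]
  congr 1
  · rw [Finset.prod_congr rfl (g := fun _ => ∑' k, f k) fun j hj => by
      simp only [if_neg (Finset.ne_of_mem_erase hj), mul_one], Finset.prod_const,
      Finset.card_erase_of_mem (Finset.mem_univ s), Finset.card_univ, Fintype.card_fin]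
  · simp only [if_true]

theorem sum_rpow_le {ι : Type*} (s : Finset ι) (f : ι → ℝ≥0∞) {p : ℝ} (hp : 0 < p)
    (hp1 : p ≤ 1) : (∑ i ∈ s, f i) ^ p ≤ ∑ i ∈ s, f i ^ p :=
  s.le_sum_of_subadditive (· ^ p) (ENNReal.zero_rpow_of_pos hp).le
    (fun a b => ENNReal.rpow_add_le_add_rpow a b hp.le hp1) f

theorem tsum_rpow_le {ι : Type*} (f : ι → ℝ≥0∞) {p : ℝ} (hp : 0 < p) (hp1 : p ≤ 1) :
    (∑' i, f i) ^ p ≤ ∑' i, f i ^ p := by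
  rw [← ENNReal.le_rpow_inv_iff hp, ENNReal.tsum_eq_iSup_sum]
  refine iSup_le fun s => ?_
  rw [ENNReal.le_rpow_inv_iff hp]
  exact (sum_rpow_le s f hp hp1).trans (ENNReal.sum_le_tsum s)

theorem tsum_mul_sq_le {ι : Type*} (f g : ι → ℝ≥0∞) :
    (∑' i, f i * g i) ^ 2 ≤ (∑' i, f i ^ 2) * ∑' i, g i ^ 2 := by
  let _ : MeasurableSpace ι := ⊤
  have holder := ENNReal.lintegral_mul_le_Lp_mul_Lq (Measure.count : Measure ι)
    Real.HolderConjugate.two_two (f := f) (g := g) measurable_from_top.aemeasurable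
    measurable_from_top.aemeasurable
  simp only [lintegral_count, Pi.mul_apply, ENNReal.rpow_two] at holder
  refine (pow_le_pow_left' holder 2).trans_eq ?_
  rw [mul_pow, ← ENNReal.rpow_natCast, ← ENNReal.rpow_natCast, ← ENNReal.rpow_mul,
    ← ENNReal.rpow_mul]
  norm_num

theorem enorm_tsum_sq_le {ι E : Type*} [NormedAddCommGroup E] [CompleteSpace E] (c : ι → E)
    {ρ : ι → ℝ≥0∞} (hρ : ∀ i, ρ i ≠ 0) (hρ' : ∀ i, ρ i ≠ ∞) :
    ‖∑' i, c i‖ₑ ^ 2 ≤ (∑' i, ρ i) * ∑' i, ‖c i‖ₑ ^ 2 / ρ i := by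
  let r i := ρ i ^ (2⁻¹ : ℝ)
  have hr i : r i ^ 2 = ρ i := by
    rw [← ENNReal.rpow_two, ENNReal.rpow_inv_rpow two_ne_zero]
  have hsplit i : ‖c i‖ₑ = r i * (‖c i‖ₑ / r i) := by
    refine (ENNReal.mul_div_cancel ?_ ?_).symm
    · exact fun h => hρ i (by rw [← hr, h, zero_pow two_ne_zero])
    · exact ENNReal.rpow_ne_top_of_nonneg (by norm_num) (hρ' i)
  calc ‖∑' i, c i‖ₑ ^ 2 ≤ (∑' i, r i * (‖c i‖ₑ / r i)) ^ 2 := by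
        simp_rw [← hsplit]
        gcongr
        exact enorm_tsum_le_tsum_enorm
    _ ≤ _ := tsum_mul_sq_le _ _
    _ = _ := by simp_rw [div_eq_mul_inv, mul_pow, ← ENNReal.inv_pow, hr]

theorem tsum_eq_add_tsum_compl {ι : Type*} (f : ι → ℝ≥0∞) (i : ι) :
    ∑' j, f j = f i + ∑' j : ({i}ᶜ : Set ι), f j := by
  rw [← ENNReal.summable.tsum_add_tsum_compl (s := {i}) ENNReal.summable, tsum_singleton i f]

/-! ### Autocorrelation -/

/-- The autocorrelation `l ↦ ∑ₕ ρ(h) ρ(h + l)` of a weight function `ρ`. -/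
noncomputable def autocorr {G : Type*} [Add G] (ρ : G → ℝ≥0∞) (l : G) : ℝ≥0∞ :=
  ∑' h, ρ h * ρ (h + l)

theorem tsum_autocorr {G : Type*} [AddGroup G] (ρ : G → ℝ≥0∞) :
    ∑' l, autocorr ρ l = (∑' h, ρ h) ^ 2 := by
  unfold autocorr
  rw [ENNReal.tsum_comm, sq, ← ENNReal.tsum_mul_right]
  refine tsum_congr fun h => ?_
  exact ENNReal.tsum_mul_left.trans (congrArg _ ((Equiv.addLeft h).tsum_eq ρ))

theorem autocorr_rpow_le {G : Type*} [Add G] (ρ : G → ℝ≥0∞) (l : G) {p : ℝ} (hp : 0 < p)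
    (hp1 : p ≤ 1) : autocorr ρ l ^ p ≤ autocorr (fun h => ρ h ^ p) l := by
  refine (tsum_rpow_le _ hp hp1).trans_eq (tsum_congr fun h => ?_)
  rw [ENNReal.mul_rpow_of_nonneg _ _ hp.le]

theorem autocorr_prod {G : Type*} [Add G] {d : ℕ} (ρ : G → ℝ≥0∞) (l : Fin d → G) :
    autocorr (fun h : Fin d → G => ∏ j, ρ (h j)) l = ∏ j, autocorr ρ (l j) := by
  simp only [autocorr, Pi.add_apply, ← Finset.prod_mul_distrib]
  exact tsum_prod_apply fun j k => ρ k * ρ (k + l j)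

theorem one_le_autocorr_zero {G : Type*} [AddZeroClass G] (ρ : G → ℝ≥0∞) (h0 : ρ 0 = 1) :
    1 ≤ autocorr ρ 0 := by
  simpa [h0, autocorr] using ENNReal.le_tsum (f := fun h => ρ h * ρ (h + 0)) 0

theorem tsum_compl_zero_autocorr_le {G : Type*} [AddGroup G] (ρ : G → ℝ≥0∞) (h0 : ρ 0 = 1) :
    ∑' l : ({0}ᶜ : Set G), autocorr ρ l ≤ 2 * (∑' h, ρ h) * ∑' h : ({0}ᶜ : Set G), ρ h := by
  set m := ∑' h : ({0}ᶜ : Set G), ρ h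
  have htotal : ∑' h, ρ h = 1 + m := by rw [tsum_eq_add_tsum_compl ρ 0, h0]
  rw [htotal, ← ENNReal.add_le_add_iff_left ENNReal.one_ne_top]
  calc 1 + ∑' l : ({0}ᶜ : Set G), autocorr ρ l
      ≤ autocorr ρ 0 + ∑' l : ({0}ᶜ : Set G), autocorr ρ l := by
        gcongr
        exact one_le_autocorr_zero ρ h0
    _ = (1 + m) ^ 2 := by rw [← tsum_eq_add_tsum_compl, tsum_autocorr, htotal]
    _ ≤ (1 + m) ^ 2 + m ^ 2 := le_self_add
    _ = 1 + 2 * (1 + m) * m := by ring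

theorem autocorr_le {G : Type*} [AddGroup G] (ρ : G → ℝ≥0∞) {l : G} {ε : ℝ≥0∞}
    (hε : ∀ h, ρ h ≤ ε ∨ ρ (h + l) ≤ ε) : autocorr ρ l ≤ 2 * ε * ∑' h, ρ h := by
  calc autocorr ρ l ≤ ∑' h, (ε * ρ (h + l) + ε * ρ h) := by
        refine ENNReal.tsum_le_tsum fun h => ?_
        rcases hε h with hh | hh
        · exact le_add_right (mul_le_mul_left hh _)
        · exact le_add_left ((mul_le_mul_right hh _).trans_eq (mul_comm _ _))
    _ = 2 * ε * ∑' h, ρ h := by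
        have hshift : ∑' h, ρ (h + l) = ∑' h, ρ h := (Equiv.addRight l).tsum_eq ρ
        rw [ENNReal.tsum_add, ENNReal.tsum_mul_left, ENNReal.tsum_mul_left, hshift]
        ring

/-! ### Dual vectors of a rank-1 lattice -/

/-- The nonzero vectors of the dual lattice of `z`, the index set of the inner sum in `S(z)`. -/
def nonzeroDual (N : ℕ) {d : ℕ} (z : Fin d → ℕ) : Set (Fin d → ℤ) := {l | l ≠ 0 ∧ InDual N z l}

/-- The vectors of the dual lattice of `z` whose last nonzero component has index `s`, the index
set of the inner sum in `T_s(z)`. -/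
def lastDual (N : ℕ) {d : ℕ} (s : Fin d) (z : Fin d → ℕ) : Set (Fin d → ℤ) :=
  {l | l s ≠ 0 ∧ (∀ j, s < j → l j = 0) ∧ InDual N z l}

theorem nonzeroDual_subset_iUnion_lastDual (N : ℕ) {d : ℕ} (z : Fin d → ℕ) :
    nonzeroDual N z ⊆ ⋃ s, lastDual N s z := by
  rintro l ⟨hl, hdual⟩
  obtain ⟨s, hs⟩ := (Set.toFinite {j | l j ≠ 0}).exists_maximal (Function.ne_iff.mp hl)
  refine Set.mem_iUnion.mpr ⟨s, hs.prop, fun j hj => ?_, hdual⟩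
  by_contra hlj
  exact hj.not_ge (hs.le_of_ge hlj hj.le)

theorem inDual_congr (N : ℕ) {d : ℕ} {s : Fin d} {z z' : Fin d → ℕ} {l : Fin d → ℤ}
    (hz : ∀ j ≤ s, z j = z' j) (hl : ∀ j, s < j → l j = 0) : InDual N z l ↔ InDual N z' l := by
  have hsum : ∑ j, l j * (z j : ℤ) = ∑ j, l j * (z' j : ℤ) := by
    refine Finset.sum_congr rfl fun j _ => ?_
    rcases le_or_gt j s with hj | hj
    · rw [hz j hj]
    · rw [hl j hj, zero_mul, zero_mul]
  rw [InDual, InDual, hsum]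

theorem lastDual_congr (N : ℕ) {d : ℕ} {s : Fin d} {z z' : Fin d → ℕ}
    (hz : ∀ j ≤ s, z j = z' j) : lastDual N s z = lastDual N s z' :=
  Set.ext fun _ => and_congr_right fun _ => and_congr_right (inDual_congr N hz)

theorem sum_mul_update {d : ℕ} (l : Fin d → ℤ) (z : Fin d → ℕ) (s : Fin d) (c : ℕ) :
    ∑ j, l j * ((Function.update z s c j : ℕ) : ℤ) =
      l s * c + ∑ j ∈ Finset.univ.erase s, l j * (z j : ℤ) := by
  rw [← Finset.add_sum_erase _ _ (Finset.mem_univ s), Function.update_self]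
  congr 1
  refine Finset.sum_congr rfl fun j hj => ?_
  rw [Function.update_of_ne (Finset.ne_of_mem_erase hj)]

theorem eq_of_inDual_update {N : ℕ} (hN : N.Prime) {d : ℕ} {s : Fin d} {z : Fin d → ℕ}
    {l : Fin d → ℤ} (hl : ¬ (N : ℤ) ∣ l s) {a b : ℕ} (ha : a ∈ Finset.Icc 1 (N - 1))
    (hb : b ∈ Finset.Icc 1 (N - 1)) (hla : InDual N (Function.update z s a) l)
    (hlb : InDual N (Function.update z s b) l) : a = b := by
  have hdvd : (N : ℤ) ∣ l s * (a - b) := by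
    have h := dvd_sub hla hlb
    rwa [sum_mul_update, sum_mul_update, add_sub_add_right_eq_sub, ← mul_sub] at h
  have hdvd' : (N : ℤ) ∣ (a : ℤ) - b :=
    ((Nat.prime_iff_prime_int.mp hN).dvd_or_dvd hdvd).resolve_left hl
  rw [Finset.mem_Icc] at ha hb
  have hlt : |(a : ℤ) - b| < N := by rw [abs_lt]; omega
  have := Int.eq_zero_of_abs_lt_dvd hdvd' hlt
  omega

open Classical in
theorem card_filter_inDual_update_le {N : ℕ} (hN : N.Prime) {d : ℕ} (s : Fin d) (z : Fin d → ℕ)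
    (l : Fin d → ℤ) :
    ((Finset.Icc 1 (N - 1)).filter fun c => InDual N (Function.update z s c) l).card ≤
      1 + if (N : ℤ) ∣ l s then N - 1 else 0 := by
  split_ifs with hl
  · exact (Finset.card_filter_le _ _).trans (by simp)
  · refine Finset.card_le_one.mpr fun a ha b hb => ?_
    rw [Finset.mem_filter] at ha hb
    exact eq_of_inDual_update hN hl ha.1 hb.1 ha.2 hb.2

theorem tsum_compl_zero_ite_dvd {N : ℕ} (hN : N ≠ 0) (R : ℤ → ℝ≥0∞) :
    ∑' k : ({0}ᶜ : Set ℤ), (if (N : ℤ) ∣ k then R k else 0) =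
      ∑' m : ({0}ᶜ : Set ℤ), R (N * m) := by
  have hinj : Function.Injective fun m : ℤ => (N : ℤ) * m :=
    mul_right_injective₀ (Int.natCast_ne_zero.mpr hN)
  rw [tsum_subtype ({0}ᶜ : Set ℤ) fun k => if (N : ℤ) ∣ k then R k else 0,
    tsum_subtype ({0}ᶜ : Set ℤ) fun m => R (N * m), ← hinj.tsum_eq]
  · refine tsum_congr fun m => ?_
    by_cases hm : m = 0 <;> simp [hm, hN]
  · intro k hk
    have hdvd : (N : ℤ) ∣ k := by
      by_contra hndvd
      simp [hndvd] at hk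
    exact hdvd.imp fun _ => Eq.symm

theorem sum_indicator_lastDual_update_le {N : ℕ} (hN : N.Prime) {d : ℕ} (s : Fin d)
    (z : Fin d → ℕ) (F : (Fin d → ℤ) → ℝ≥0∞) (l : Fin d → ℤ) :
    ∑ c ∈ Finset.Icc 1 (N - 1), (lastDual N s (Function.update z s c)).indicator F l ≤
      F l * ({0}ᶜ : Set ℤ).indicator
        (fun k => 1 + ((N - 1 : ℕ) : ℝ≥0∞) * if (N : ℤ) ∣ k then 1 else 0) (l s) := by
  classical
  by_cases hl : l s = 0
  · simp [lastDual, hl]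
  calc _ ≤ ∑ c ∈ Finset.Icc 1 (N - 1), if InDual N (Function.update z s c) l then F l else 0 := by
        refine Finset.sum_le_sum fun c _ => Set.indicator_apply_le' (fun hmem => ?_)
          fun _ => zero_le
        rw [if_pos hmem.2.2]
    _ = F l * ((Finset.Icc 1 (N - 1)).filter fun c => InDual N (Function.update z s c) l).card := by
        rw [← Finset.sum_filter, Finset.sum_const, nsmul_eq_mul, mul_comm]
    _ ≤ F l * (1 + if (N : ℤ) ∣ l s then N - 1 else 0 : ℕ) := by
        gcongr
        exact card_filter_inDual_update_le hN s z l
    _ = _ := by simp [hl]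

theorem sum_tsum_lastDual_update_le {N : ℕ} (hN : N.Prime) {d : ℕ} (s : Fin d) (z : Fin d → ℕ)
    (R : ℤ → ℝ≥0∞) :
    ∑ c ∈ Finset.Icc 1 (N - 1), ∑' l : lastDual N s (Function.update z s c), ∏ j, R (l.1 j) ≤
      (∑' k, R k) ^ (d - 1) * (∑' k : ({0}ᶜ : Set ℤ), R k +
        (N - 1 : ℕ) * ∑' m : ({0}ᶜ : Set ℤ), R (N * m)) := by
  let F (l : Fin d → ℤ) := ∏ j, R (l j)
  let u : ℤ → ℝ≥0∞ := Set.indicator {0}ᶜ fun k => 1 + (N - 1 : ℕ) * if (N : ℤ) ∣ k then 1 else 0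
  calc _ = ∑' l, ∑ c ∈ Finset.Icc 1 (N - 1),
        (lastDual N s (Function.update z s c)).indicator F l := by
        rw [Summable.tsum_finsetSum fun _ _ => ENNReal.summable]
        exact Finset.sum_congr rfl fun c _ => tsum_subtype _ F
    _ ≤ ∑' l, F l * u (l s) :=
        ENNReal.tsum_le_tsum (sum_indicator_lastDual_update_le hN s z F)
    _ = (∑' k, R k) ^ (d - 1) * ∑' k, R k * u k := tsum_prod_mul_apply R u s
    _ = (∑' k, R k) ^ (d - 1) * ∑' k : ({0}ᶜ : Set ℤ),
          (R k + (N - 1 : ℕ) * if (N : ℤ) ∣ k then R k else 0) := by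
        rw [tsum_subtype ({0}ᶜ : Set ℤ) fun k =>
            R k + (N - 1 : ℕ) * if (N : ℤ) ∣ k then R k else 0]
        congr! with k
        by_cases hk : k = 0 <;> by_cases hdvd : (N : ℤ) ∣ k <;>
          simp [u, hk, hdvd, mul_add, mul_comm]
    _ = _ := by rw [ENNReal.tsum_add, ENNReal.tsum_mul_left, tsum_compl_zero_ite_dvd hN.ne_zero]

/-! ### Power weights -/

/-- The weight `|2πk|^{-β}`, with value `1` at `k = 0`; for `β = 2α` it is the one-dimensional
factor of `r_α(h)^{-2}`. -/
noncomputable def powWeight (β : ℝ) (k : ℤ) : ℝ≥0∞ :=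
  ENNReal.ofReal (if k = 0 then 1 else |2 * Real.pi * (k : ℝ)| ^ (-β))

/-- The product of the weights `powWeight β` over the coordinates, equal to `r_α(h)^{-2}` for
`β = 2α`. -/
noncomputable def prodWeight (β : ℝ) {d : ℕ} (h : Fin d → ℤ) : ℝ≥0∞ := ∏ j, powWeight β (h j)

/-- The sum of `|2πk|^{-β}` over all nonzero integers `k`, the bracket in the constant
`C_{α,δ,d}`. -/
noncomputable def zetaMass (β : ℝ) : ℝ := 2 * (1 / (2 * Real.pi)) ^ β * realZeta β

theorem abs_two_pi_mul_pos {k : ℤ} (hk : k ≠ 0) : 0 < |2 * Real.pi * (k : ℝ)| :=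
  abs_pos.mpr (mul_ne_zero Real.two_pi_pos.ne' (Int.cast_ne_zero.mpr hk))

theorem powWeight_zero (β : ℝ) : powWeight β 0 = 1 := by simp [powWeight]

theorem powWeight_of_ne (β : ℝ) {k : ℤ} (hk : k ≠ 0) :
    powWeight β k = ENNReal.ofReal (|2 * Real.pi * (k : ℝ)| ^ (-β)) := by simp [powWeight, hk]

theorem powWeight_ne_zero (β : ℝ) (k : ℤ) : powWeight β k ≠ 0 := by
  rcases eq_or_ne k 0 with rfl | hk
  · simp [powWeight_zero]
  · rw [powWeight_of_ne β hk]
    exact (ENNReal.ofReal_pos.mpr (Real.rpow_pos_of_pos (abs_two_pi_mul_pos hk) _)).ne'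

theorem powWeight_rpow (β : ℝ) {p : ℝ} (hp : 0 ≤ p) (k : ℤ) :
    powWeight β k ^ p = powWeight (β * p) k := by
  rcases eq_or_ne k 0 with rfl | hk
  · simp [powWeight_zero]
  · rw [powWeight_of_ne _ hk, powWeight_of_ne _ hk,
      ENNReal.ofReal_rpow_of_nonneg (by positivity) hp, ← Real.rpow_mul (abs_nonneg _), neg_mul]

theorem prodWeight_ne_zero (β : ℝ) {d : ℕ} (h : Fin d → ℤ) : prodWeight β h ≠ 0 :=
  Finset.prod_ne_zero_iff.mpr fun j _ => powWeight_ne_zero β (h j)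

theorem prodWeight_ne_top (β : ℝ) {d : ℕ} (h : Fin d → ℤ) : prodWeight β h ≠ ∞ :=
  ENNReal.prod_ne_top fun _ _ => ENNReal.ofReal_ne_top

theorem prodWeight_rpow (β : ℝ) {p : ℝ} (hp : 0 ≤ p) {d : ℕ} (h : Fin d → ℤ) :
    prodWeight β h ^ p = prodWeight (β * p) h := by
  simp only [prodWeight, ← ENNReal.prod_rpow_of_nonneg hp, powWeight_rpow β hp]

theorem realZeta_nonneg (β : ℝ) : 0 ≤ realZeta β := tsum_nonneg fun _ => by positivity

theorem zetaMass_nonneg (β : ℝ) : 0 ≤ zetaMass β :=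
  mul_nonneg (by positivity) (realZeta_nonneg β)

theorem hasSum_two_pi_mul_succ_rpow {β : ℝ} (hβ : 1 < β) :
    HasSum (fun n : ℕ => |2 * Real.pi * ((n : ℝ) + 1)| ^ (-β))
      ((1 / (2 * Real.pi)) ^ β * realZeta β) := by
  have hsum : Summable fun n : ℕ => 1 / ((n : ℝ) + 1) ^ β := by
    simpa using (summable_nat_add_iff 1).mpr (Real.summable_one_div_nat_rpow.mpr hβ)
  refine (hsum.hasSum.mul_left ((1 / (2 * Real.pi)) ^ β)).congr_fun fun n => ?_
  rw [abs_of_pos (by positivity), Real.mul_rpow (by positivity) (by positivity),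
    Real.rpow_neg (by positivity), Real.rpow_neg (by positivity),
    Real.div_rpow zero_le_one (by positivity), Real.one_rpow, one_div, one_div]

theorem hasSum_abs_two_pi_mul_rpow {β : ℝ} (hβ : 1 < β) :
    HasSum (fun k : ℤ => if k = 0 then (0 : ℝ) else |2 * Real.pi * (k : ℝ)| ^ (-β))
      (zetaMass β) := by
  have hhalf := hasSum_two_pi_mul_succ_rpow hβ
  have hfull := HasSum.of_add_one_of_neg_add_one
    (f := fun k : ℤ => if k = 0 then (0 : ℝ) else |2 * Real.pi * (k : ℝ)| ^ (-β))
    (hhalf.congr_fun fun n => by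
      rw [if_neg (by omega), Int.cast_add, Int.cast_natCast, Int.cast_one])
    (hhalf.congr_fun fun n => by
      rw [if_neg (by omega), Int.cast_neg, Int.cast_add, Int.cast_natCast, Int.cast_one, mul_neg,
        abs_neg])
  convert hfull using 1
  simp only [if_true, zetaMass]
  ring

theorem tsum_compl_zero_powWeight {β : ℝ} (hβ : 1 < β) :
    ∑' k : ({0}ᶜ : Set ℤ), powWeight β k = ENNReal.ofReal (zetaMass β) := by
  have hsum := hasSum_abs_two_pi_mul_rpow hβ
  rw [← hsum.tsum_eq, ENNReal.ofReal_tsum_of_nonneg (fun k => by positivity) hsum.summable,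
    tsum_subtype ({0}ᶜ : Set ℤ) (powWeight β)]
  refine tsum_congr fun k => ?_
  by_cases hk : k = 0 <;> simp [hk, powWeight_of_ne]

theorem tsum_powWeight {β : ℝ} (hβ : 1 < β) :
    ∑' k : ℤ, powWeight β k = ENNReal.ofReal (1 + zetaMass β) := by
  rw [tsum_eq_add_tsum_compl _ 0, powWeight_zero, tsum_compl_zero_powWeight hβ,
    ENNReal.ofReal_add zero_le_one (zetaMass_nonneg β), ENNReal.ofReal_one]

theorem tsum_prodWeight_ne_top {β : ℝ} (hβ : 1 < β) (d : ℕ) :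
    ∑' h : Fin d → ℤ, prodWeight β h ≠ ∞ := by
  unfold prodWeight
  rw [tsum_prod_apply fun _ => powWeight β, tsum_powWeight hβ]
  exact ENNReal.prod_ne_top fun _ _ => ENNReal.ofReal_ne_top

theorem powWeight_le_mul {β : ℝ} (hβ : 0 ≤ β) {N : ℕ} (hN : 0 < N) {k m : ℤ} (hm : m ≠ 0)
    (hkm : N * |m| ≤ 2 * |k|) :
    powWeight β k ≤ ENNReal.ofReal ((2 / N : ℝ) ^ β) * powWeight β m := by
  have : (0 : ℝ) < N := Nat.cast_pos.mpr hN
  have hk : k ≠ 0 := by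
    rintro rfl
    have : 0 < (N : ℤ) * |m| := mul_pos (Int.natCast_pos.mpr hN) (abs_pos.mpr hm)
    rw [abs_zero] at hkm
    omega
  have hkm' : (N : ℝ) * |(m : ℝ)| ≤ 2 * |(k : ℝ)| := by exact_mod_cast hkm
  have hm' := abs_two_pi_mul_pos hm
  rw [powWeight_of_ne _ hk, powWeight_of_ne _ hm, ← ENNReal.ofReal_mul (by positivity)]
  refine ENNReal.ofReal_le_ofReal ?_
  calc |2 * Real.pi * (k : ℝ)| ^ (-β) ≤ ((2 / N : ℝ)⁻¹ * |2 * Real.pi * (m : ℝ)|) ^ (-β) := by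
        refine Real.rpow_le_rpow_of_nonpos (by positivity) ?_ (by linarith)
        rw [abs_mul _ (m : ℝ), abs_mul _ (k : ℝ), abs_of_pos Real.two_pi_pos, inv_div]
        nlinarith [Real.pi_pos]
    _ = (2 / N : ℝ) ^ β * |2 * Real.pi * (m : ℝ)| ^ (-β) := by
        rw [Real.mul_rpow (by positivity) hm'.le, Real.inv_rpow (by positivity),
          Real.rpow_neg (by positivity), inv_inv]

theorem autocorr_powWeight_mul_le {β : ℝ} (hβ : 0 ≤ β) {N : ℕ} (hN : 0 < N) {m : ℤ}
    (hm : m ≠ 0) : autocorr (powWeight β) (N * m) ≤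
      2 * (ENNReal.ofReal ((2 / N : ℝ) ^ β) * powWeight β m) * ∑' k, powWeight β k := by
  refine autocorr_le _ fun h => ?_
  have htriangle : (N : ℤ) * |m| ≤ |h| + |h + N * m| := by
    have := abs_sub (h + N * m) h
    rw [add_sub_cancel_left, abs_mul, Nat.abs_cast] at this
    linarith
  rcases le_total (N * |m|) (2 * |h|) with hh | hh
  · exact .inl (powWeight_le_mul hβ hN hm hh)
  · exact .inr (powWeight_le_mul hβ hN hm (by linarith))

/-! ### The criteria -/

/-- The sum of `prodWeight β h * prodWeight β (h + ℓ)` over all `h ∈ ℤ^d` and `ℓ ∈ L`: both `S(z)`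
and `T_s(z)` are of this form, with `β = 2α`. -/
noncomputable def shiftSum (β : ℝ) {d : ℕ} (L : Set (Fin d → ℤ)) : ℝ≥0∞ :=
  ∑' l : L, autocorr (prodWeight β) l.1

theorem shiftSum_mono (β : ℝ) {d : ℕ} {L L' : Set (Fin d → ℤ)} (hL : L ⊆ L') :
    shiftSum β L ≤ shiftSum β L' :=
  ENNReal.tsum_mono_subtype _ hL

theorem shiftSum_rpow_le (β : ℝ) {d : ℕ} (L : Set (Fin d → ℤ)) {p : ℝ} (hp : 0 < p)
    (hp1 : p ≤ 1) : shiftSum β L ^ p ≤ shiftSum (β * p) L := by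
  refine (tsum_rpow_le _ hp hp1).trans (ENNReal.tsum_le_tsum fun l => ?_)
  simpa only [prodWeight_rpow β hp.le] using autocorr_rpow_le (prodWeight β) l.1 hp hp1

theorem shiftSum_ne_top {β : ℝ} (hβ : 1 < β) {d : ℕ} (L : Set (Fin d → ℤ)) :
    shiftSum β L ≠ ∞ := by
  refine ne_top_of_le_ne_top ?_ (ENNReal.tsum_comp_le_tsum_of_injective Subtype.val_injective _)
  rw [tsum_autocorr]
  exact ENNReal.pow_ne_top (tsum_prodWeight_ne_top hβ d)

theorem shiftSum_nonzeroDual_le (β : ℝ) (N : ℕ) {d : ℕ} (z : Fin d → ℕ) :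
    shiftSum β (nonzeroDual N z) ≤ ∑ s, shiftSum β (lastDual N s z) := by
  refine (shiftSum_mono β (nonzeroDual_subset_iUnion_lastDual N z)).trans ?_
  exact ENNReal.tsum_iUnion_le _ _

theorem cubeWeight_pos (α : ℕ) {d : ℕ} (h : Fin d → ℤ) : 0 < cubeWeight α h :=
  Finset.prod_pos fun j _ => by
    split_ifs with hj
    · exact one_pos
    · exact pow_pos (abs_two_pi_mul_pos hj) α

theorem prodWeight_two_mul (α : ℕ) {d : ℕ} (h : Fin d → ℤ) :
    prodWeight (2 * α) h = ENNReal.ofReal (1 / cubeWeight α h ^ 2) := by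
  unfold cubeWeight prodWeight powWeight
  rw [← ENNReal.ofReal_prod_of_nonneg fun j _ => by positivity,
    ← Finset.prod_pow, one_div, ← Finset.prod_inv_distrib]
  congr 1
  refine Finset.prod_congr rfl fun j _ => ?_
  split_ifs with hj
  · simp
  · rw [Real.rpow_neg (abs_nonneg _), ← pow_mul, mul_comm α 2, ← Real.rpow_natCast,
      Nat.cast_mul, Nat.cast_two]

theorem one_lt_two_mul_cast {α : ℕ} (hα : 1 ≤ α) : (1 : ℝ) < 2 * α := by
  have : (1 : ℝ) ≤ α := Nat.one_le_cast.mpr hα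
  linarith

theorem toReal_shiftSum {α : ℕ} (hα : 1 ≤ α) {d : ℕ} (L : Set (Fin d → ℤ)) :
    (shiftSum (2 * α) L).toReal = ∑' h : Fin d → ℤ, ∑' l : L,
      1 / (cubeWeight α h ^ 2 * cubeWeight α (h + l.1) ^ 2) := by
  have hfin := shiftSum_ne_top (one_lt_two_mul_cast hα) L
  unfold shiftSum autocorr at hfin ⊢
  rw [ENNReal.tsum_comm] at hfin ⊢
  have hfin' := ENNReal.ne_top_of_tsum_ne_top hfin
  rw [ENNReal.tsum_toReal_eq hfin']
  refine tsum_congr fun h => ?_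
  rw [ENNReal.tsum_toReal_eq (ENNReal.ne_top_of_tsum_ne_top (hfin' h))]
  refine tsum_congr fun l => ?_
  rw [prodWeight_two_mul, prodWeight_two_mul, ENNReal.toReal_mul,
    ENNReal.toReal_ofReal (by positivity), ENNReal.toReal_ofReal (by positivity),
    one_div_mul_one_div]

theorem latticeCriterion_nonneg (α N : ℕ) {d : ℕ} (z : Fin d → ℕ) : 0 ≤ latticeCriterion α N z :=
  tsum_nonneg fun _ => tsum_nonneg fun _ => by positivity

theorem latticeCriterion_eq {α : ℕ} (hα : 1 ≤ α) (N : ℕ) {d : ℕ} (z : Fin d → ℕ) :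
    latticeCriterion α N z = (shiftSum (2 * α) (nonzeroDual N z)).toReal :=
  (toReal_shiftSum hα (nonzeroDual N z)).symm

theorem cbcCriterion_eq {α : ℕ} (hα : 1 ≤ α) (N : ℕ) {d : ℕ} (s : Fin d) (z : Fin d → ℕ) :
    cbcCriterion α N s z = (shiftSum (2 * α) (lastDual N s z)).toReal :=
  (toReal_shiftSum hα (lastDual N s z)).symm

/-! ### The component-by-component construction -/

theorem exists_componentwise_minimizer {ι β γ : Type*} [Finite ι] [LinearOrder ι] [LinearOrder γ]
    (f : ι → (ι → β) → γ) (hf : ∀ s z w, (∀ j ≤ s, z j = w j) → f s z = f s w)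
    {A : Finset β} (hA : A.Nonempty) :
    ∃ z : ι → β, ∀ s, z s ∈ A ∧ ∀ c ∈ A, f s z ≤ f s (Function.update z s c) := by
  cases nonempty_fintype ι
  obtain ⟨z, hz, hmin⟩ := (Fintype.piFinset fun _ : ι => A).exists_min_image
    (fun z => toLex fun s => f s z) (Fintype.piFinset_nonempty.mpr fun _ => hA)
  rw [Fintype.mem_piFinset] at hz
  refine ⟨z, fun s => ⟨hz s, fun c hc => not_lt.mp fun hlt => ?_⟩⟩
  refine (hmin (Function.update z s c) ?_).not_gt ⟨s, fun j hj => ?_, hlt⟩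
  · exact Fintype.mem_piFinset.mpr fun j => by
      rcases eq_or_ne j s with rfl | hj
      · rwa [Function.update_self]
      · rw [Function.update_of_ne hj]
        exact hz j
  · exact hf j _ _ fun i hi => Function.update_of_ne (hi.trans_lt hj).ne _ _

theorem exists_isCBC {α : ℕ} (hα : 1 ≤ α) {N : ℕ} (hN : 2 ≤ N) (d : ℕ) :
    ∃ z : Fin d → ℕ, IsCBC α N z := by
  have hA : (Finset.Icc 1 (N - 1)).Nonempty := Finset.nonempty_Icc.mpr (by omega)
  obtain ⟨z, hz⟩ := exists_componentwise_minimizer (cbcCriterion α N (d := d))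
    (fun s z w hzw => by rw [cbcCriterion_eq hα, cbcCriterion_eq hα, lastDual_congr N hzw]) hA
  exact ⟨z, fun s => by simpa only [Finset.mem_Icc, ← Set.mem_Icc] using hz s⟩

theorem two_add_le_sub_one_mul {x β : ℝ} (hx : 2 ≤ x) (hβ : 1 ≤ β) :
    2 + (x - 1) * (2 * (2 / x) ^ β) ≤ (x - 1) * ((4 + 2 ^ (β + 1)) / x) := by
  have hfour : 2 ≤ (x - 1) * (4 / x) := by
    rw [mul_div_assoc', le_div_iff₀ (by linarith)]
    linarith
  have hpow : (2 / x) ^ β ≤ 2 ^ β / x := by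
    rw [Real.div_rpow two_pos.le (by linarith)]
    gcongr
    exact Real.self_le_rpow_of_one_le (by linarith) hβ
  calc 2 + (x - 1) * (2 * (2 / x) ^ β)
      ≤ (x - 1) * (4 / x) + (x - 1) * (2 * (2 ^ β / x)) := by
        gcongr
        linarith
    _ = _ := by rw [Real.rpow_add_one two_ne_zero]; ring

theorem sum_shiftSum_lastDual_update_le {β : ℝ} (hβ : 1 < β) {N : ℕ} (hN : N.Prime) {d : ℕ}
    (s : Fin d) (z : Fin d → ℕ) :
    ∑ c ∈ Finset.Icc 1 (N - 1), shiftSum β (lastDual N s (Function.update z s c)) ≤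
      ENNReal.ofReal ((2 + (N - 1) * (2 * (2 / N : ℝ) ^ β)) *
        (zetaMass β * (1 + zetaMass β) ^ (2 * d - 1))) := by
  have hm := zetaMass_nonneg β
  have hT := tsum_powWeight hβ
  have hM := tsum_compl_zero_powWeight hβ
  set T := ∑' k, powWeight β k
  set M := ∑' k : ({0}ᶜ : Set ℤ), powWeight β k
  set ε := ENNReal.ofReal ((2 / N : ℝ) ^ β) with hε
  have hmultiples : ∑' m : ({0}ᶜ : Set ℤ), autocorr (powWeight β) (N * m) ≤ 2 * ε * M * T := by
    refine (ENNReal.tsum_le_tsum fun m : ({0}ᶜ : Set ℤ) =>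
      autocorr_powWeight_mul_le (by linarith) hN.pos m.2).trans_eq ?_
    rw [ENNReal.tsum_mul_right, ENNReal.tsum_mul_left, ENNReal.tsum_mul_left, ← mul_assoc 2]
  calc _ = ∑ c ∈ Finset.Icc 1 (N - 1), ∑' l : lastDual N s (Function.update z s c),
        ∏ j, autocorr (powWeight β) (l.1 j) := by
        simp_rw [shiftSum, ← autocorr_prod]
        rfl
    _ ≤ (T ^ 2) ^ (d - 1) * (2 * T * M + (N - 1 : ℕ) * (2 * ε * M * T)) := by
        rw [← tsum_autocorr]
        refine (sum_tsum_lastDual_update_le hN s z _).trans ?_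
        gcongr
        exact tsum_compl_zero_autocorr_le _ (powWeight_zero β)
    _ = (2 + (N - 1 : ℕ) * (2 * ε)) * (M * T ^ (2 * d - 1)) := by
        rw [show 2 * d - 1 = 2 * (d - 1) + 1 by have := s.pos; omega, pow_succ T (2 * (d - 1)),
          pow_mul T 2]
        ring
    _ = _ := by
        have hN1 : (0 : ℝ) ≤ (N - 1 : ℕ) := by positivity
        rw [hT, hM, hε, ← Nat.cast_pred hN.pos, ENNReal.ofReal_mul (by positivity),
          ENNReal.ofReal_add two_pos.le (by positivity), ENNReal.ofReal_mul hN1,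
          ENNReal.ofReal_mul two_pos.le, ENNReal.ofReal_mul hm,
          ENNReal.ofReal_pow (by positivity), ENNReal.ofReal_natCast, ENNReal.ofReal_ofNat]

theorem IsCBC.cbcCriterion_rpow_le {α : ℕ} (hα : 1 ≤ α) {N : ℕ} (hN : N.Prime) {d : ℕ}
    {z : Fin d → ℕ} (hz : IsCBC α N z) (s : Fin d) {p : ℝ} (hp : 0 < p) (hp1 : p ≤ 1)
    (hβ : 1 < 2 * α * p) :
    cbcCriterion α N s z ^ p ≤ (4 + 2 ^ (2 * α * p + 1)) / N *
      (zetaMass (2 * α * p) * (1 + zetaMass (2 * α * p)) ^ (2 * d - 1)) := by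
  set β : ℝ := 2 * α * p
  have hm := zetaMass_nonneg β
  have hNr : (2 : ℝ) ≤ N := Nat.ofNat_le_cast.mpr hN.two_le
  have hfin (w : Fin d → ℕ) := shiftSum_ne_top (one_lt_two_mul_cast hα) (lastDual N s w)
  have hmin (c) (hc : c ∈ Finset.Icc 1 (N - 1)) : shiftSum (2 * α) (lastDual N s z) ^ p ≤
      shiftSum β (lastDual N s (Function.update z s c)) := by
    have hle := (hz s).2 c (by simpa using hc)
    rw [cbcCriterion_eq hα, cbcCriterion_eq hα, ENNReal.toReal_le_toReal (hfin _) (hfin _)] at hle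
    exact (ENNReal.rpow_le_rpow hle hp.le).trans (shiftSum_rpow_le _ _ hp hp1)
  have haverage : ((N : ℝ) - 1) * cbcCriterion α N s z ^ p ≤ (2 + (N - 1) * (2 * (2 / N) ^ β)) *
      (zetaMass β * (1 + zetaMass β) ^ (2 * d - 1)) := by
    have hsum := (Finset.sum_le_sum hmin).trans (sum_shiftSum_lastDual_update_le hβ hN s z)
    rw [Finset.sum_const, Nat.card_Icc, add_tsub_cancel_right, nsmul_eq_mul] at hsum
    have hN1 : (0 : ℝ) ≤ N - 1 := by linarith
    have hreal := ENNReal.toReal_le_of_le_ofReal (by positivity) hsum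
    rwa [ENNReal.toReal_mul, ENNReal.toReal_natCast, ← ENNReal.toReal_rpow, ← cbcCriterion_eq hα,
      Nat.cast_pred hN.pos] at hreal
  refine le_of_mul_le_mul_left (haverage.trans ?_) (by linarith : (0 : ℝ) < N - 1)
  exact (mul_le_mul_of_nonneg_right (two_add_le_sub_one_mul hNr hβ.le)
    (by positivity)).trans_eq (mul_assoc _ _ _)

theorem latticeCriterion_rpow_le_sum {α : ℕ} (hα : 1 ≤ α) (N : ℕ) {d : ℕ} (z : Fin d → ℕ) {p : ℝ}
    (hp : 0 < p) (hp1 : p ≤ 1) :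
    latticeCriterion α N z ^ p ≤ ∑ s, cbcCriterion α N s z ^ p := by
  have hfin (s : Fin d) (_ : s ∈ Finset.univ) : shiftSum (2 * α) (lastDual N s z) ^ p ≠ ∞ :=
    ENNReal.rpow_ne_top_of_nonneg hp.le (shiftSum_ne_top (one_lt_two_mul_cast hα) _)
  simp_rw [latticeCriterion_eq hα, cbcCriterion_eq hα, ENNReal.toReal_rpow]
  rw [← ENNReal.toReal_sum hfin]
  refine ENNReal.toReal_mono (ENNReal.sum_ne_top.mpr hfin) ?_
  exact (ENNReal.rpow_le_rpow (shiftSum_nonzeroDual_le _ N z) hp.le).trans (sum_rpow_le _ _ hp hp1)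

theorem IsCBC.latticeCriterion_rpow_le {α : ℕ} (hα : 1 ≤ α) {N : ℕ} (hN : N.Prime) {d : ℕ}
    {z : Fin d → ℕ} (hz : IsCBC α N z) {p : ℝ} (hp : 0 < p) (hp1 : p ≤ 1)
    (hβ : 1 < 2 * α * p) :
    latticeCriterion α N z ^ p ≤ (4 + 2 ^ (2 * α * p + 1)) / N *
      (d * zetaMass (2 * α * p) * (1 + zetaMass (2 * α * p)) ^ (2 * d - 1)) := by
  refine (latticeCriterion_rpow_le_sum hα N z hp hp1).trans ((Finset.sum_le_sum fun s _ =>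
    hz.cbcCriterion_rpow_le hα hN s hp hp1 hβ).trans_eq ?_)
  rw [Finset.sum_const, Finset.card_univ, Fintype.card_fin, nsmul_eq_mul]
  ring

theorem latticeCriterion_pos {α : ℕ} (hα : 1 ≤ α) {N : ℕ} (hN : 0 < N) {d : ℕ} (hd : 1 ≤ d)
    (z : Fin d → ℕ) : 0 < latticeCriterion α N z := by
  rw [latticeCriterion_eq hα]
  refine ENNReal.toReal_pos ?_ (shiftSum_ne_top (one_lt_two_mul_cast hα) _)
  have hmem : (fun _ => (N : ℤ)) ∈ nonzeroDual N z :=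
    ⟨Function.ne_iff.mpr ⟨⟨0, hd⟩, Int.natCast_ne_zero.mpr hN.ne'⟩,
      Finset.dvd_sum fun j _ => dvd_mul_right _ _⟩
  intro hzero
  have := ENNReal.tsum_eq_zero.mp (ENNReal.tsum_eq_zero.mp hzero ⟨_, hmem⟩) 0
  exact mul_ne_zero (prodWeight_ne_zero _ _) (prodWeight_ne_zero _ _) this

/-! ### The constant -/

theorem sum_card_mul_pow_card (ι : Type*) [Fintype ι] {R : Type*} [CommRing R] (m : R) :
    ∑ u : Finset ι, (u.card : R) * m ^ u.card =
      Fintype.card ι * m * (1 + m) ^ (Fintype.card ι - 1) := by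
  rw [← Finset.powerset_univ, Finset.sum_powerset_apply_card (fun k => (k : R) * m ^ k),
    Finset.card_univ]
  rcases Fintype.card ι with _ | n
  · simp
  rw [Finset.sum_range_succ', add_tsub_cancel_right, add_comm 1 m, add_pow, Finset.mul_sum]
  simp only [Nat.cast_zero, zero_mul, smul_zero, add_zero, nsmul_eq_mul]
  refine Finset.sum_congr rfl fun k _ => ?_
  have habsorb : ((n : R) + 1) * (n.choose k : R) = ((n + 1).choose (k + 1) : R) * (k + 1) := by
    exact_mod_cast congrArg (Nat.cast : ℕ → R) (Nat.add_one_mul_choose_eq n k)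
  rw [one_pow, pow_succ]
  push_cast
  linear_combination (-(m ^ k * m)) * habsorb

theorem card_mul_pow_le_sum (d : ℕ) {m : ℝ} (hm : 0 ≤ m) :
    d * m * (1 + m) ^ (2 * d - 1) ≤
      (∑ u : Finset (Fin d), ((max u.card 1 : ℕ) : ℝ) * m ^ u.card) ^ 2 := by
  set W := ∑ u : Finset (Fin d), ((max u.card 1 : ℕ) : ℝ) * m ^ u.card
  have hpow : (1 + m) ^ d ≤ W := by
    have hbinomial := Fintype.sum_pow_mul_eq_add_pow (Fin d) m 1
    rw [Fintype.card_fin, add_comm m 1] at hbinomial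
    rw [← hbinomial]
    refine Finset.sum_le_sum fun u _ => ?_
    rw [one_pow, mul_one]
    exact le_mul_of_one_le_left (by positivity) (Nat.one_le_cast.mpr (le_max_right _ _))
  have hcard : d * m * (1 + m) ^ (d - 1) ≤ W := by
    have hsum := sum_card_mul_pow_card (Fin d) m
    rw [Fintype.card_fin] at hsum
    rw [← hsum]
    refine Finset.sum_le_sum fun u _ => mul_le_mul_of_nonneg_right ?_ (by positivity)
    exact Nat.cast_le.mpr (le_max_left _ _)
  rcases Nat.eq_zero_or_pos d with rfl | hd
  · simpa using sq_nonneg W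
  · rw [sq, show 2 * d - 1 = (d - 1) + d by omega, pow_add, ← mul_assoc]
    exact mul_le_mul hcard hpow (by positivity) (le_trans (by positivity) hcard)

theorem four_add_two_rpow_le {β : ℝ} (hβ : 1 ≤ β) :
    (4 : ℝ) + 2 ^ (β + 1) ≤ 5 / 2 + 2 ^ (2 * β + 1) := by
  have : (2 : ℝ) ≤ 2 ^ β := Real.self_le_rpow_of_one_le one_le_two hβ
  rw [Real.rpow_add_one two_ne_zero, Real.rpow_add_one two_ne_zero, two_mul β,
    Real.rpow_add two_pos]
  nlinarith

theorem div_mul_sq_rpow {K W x : ℝ} (hK : 0 ≤ K) (hW : 0 ≤ W) (hx : 0 < x) (q : ℝ) :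
    (K / x * W ^ 2) ^ q = K ^ q * W ^ (2 * q) * x ^ (-q) := by
  rw [Real.mul_rpow (by positivity) (by positivity), Real.div_rpow hK hx.le,
    ← Real.rpow_natCast W 2, ← Real.rpow_mul hW, Real.rpow_neg hx.le, Nat.cast_two,
    div_mul_eq_mul_div, ← div_eq_mul_inv]

theorem errorConst_eq (α : ℕ) (δ : ℝ) (d : ℕ) {q β : ℝ} (hq : q = (α : ℝ) / 2 - δ)
    (hβ : β = (α : ℝ) / (2 * q)) : errorConst α δ d =
      Real.sqrt 2 * max 6 (5 / 2 + (2 : ℝ) ^ (2 * β + 1)) ^ q *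
        (∑ u : Finset (Fin d), ((max u.card 1 : ℕ) : ℝ) * zetaMass β ^ u.card) ^ (2 * q) := by
  have hq' : (α : ℝ) - 2 * δ = 2 * q := by rw [hq]; ring
  rw [errorConst, kappa, ← hq, hq', mul_div_assoc, ← hβ]
  rfl

theorem errorConst_nonneg (α : ℕ) (δ : ℝ) (d : ℕ) : 0 ≤ errorConst α δ d := by
  rw [errorConst_eq α δ d rfl rfl]
  have hm := zetaMass_nonneg ((α : ℝ) / (2 * ((α : ℝ) / 2 - δ)))
  positivity

theorem IsCBC.sqrt_two_mul_latticeCriterion_rpow_le {α : ℕ} (hα : 1 ≤ α) {N : ℕ} (hN : N.Prime)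
    {d : ℕ} {z : Fin d → ℕ} (hz : IsCBC α N z) {δ : ℝ} (hδ : 0 < δ)
    (hδ' : δ ≤ (α : ℝ) / 2 - 1 / 4) :
    Real.sqrt 2 * latticeCriterion α N z ^ (1 / 4 : ℝ) ≤
      errorConst α δ d * (N : ℝ) ^ (-((α : ℝ) / 2) + δ) := by
  obtain ⟨q, hq⟩ : ∃ q : ℝ, q = (α : ℝ) / 2 - δ := ⟨_, rfl⟩
  obtain ⟨β, hβ⟩ : ∃ β : ℝ, β = (α : ℝ) / (2 * q) := ⟨_, rfl⟩
  have hq0 : 0 < q := by linarith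
  have hβ1 : 1 < β := by rw [hβ, one_lt_div (by linarith), hq]; linarith
  have hβp : 2 * (α : ℝ) * (4 * q)⁻¹ = β := by rw [hβ]; field_simp; norm_num
  have hcbc := hz.latticeCriterion_rpow_le hα hN (p := (4 * q)⁻¹) (by positivity)
    (inv_le_one_of_one_le₀ (by linarith)) (hβp ▸ hβ1)
  rw [hβp] at hcbc
  have hm := zetaMass_nonneg β
  set K : ℝ := max 6 (5 / 2 + (2 : ℝ) ^ (2 * β + 1)) with hK
  set W : ℝ := ∑ u : Finset (Fin d), ((max u.card 1 : ℕ) : ℝ) * zetaMass β ^ u.card with hW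
  have hcriterion : latticeCriterion α N z ^ (4 * q)⁻¹ ≤ K / N * W ^ 2 := by
    refine hcbc.trans ?_
    gcongr
    · exact (four_add_two_rpow_le hβ1.le).trans (le_max_right _ _)
    · exact card_mul_pow_le_sum d hm
  calc Real.sqrt 2 * latticeCriterion α N z ^ (1 / 4 : ℝ)
      = Real.sqrt 2 * (latticeCriterion α N z ^ (4 * q)⁻¹) ^ q := by
        rw [← Real.rpow_mul (latticeCriterion_nonneg α N z)]
        congr 2
        field_simp
    _ ≤ Real.sqrt 2 * (K / N * W ^ 2) ^ q := by
        gcongr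
        exact Real.rpow_nonneg (latticeCriterion_nonneg α N z) _
    _ = errorConst α δ d * (N : ℝ) ^ (-((α : ℝ) / 2) + δ) := by
        rw [div_mul_sq_rpow (by positivity) (by positivity) (Nat.cast_pos.mpr hN.pos),
          errorConst_eq α δ d hq hβ, show -((α : ℝ) / 2) + δ = -q by rw [hq]; ring]
        ring

/-! ### Trigonometric functions on the box -/

theorem norm_cubeBasis {d : ℕ} (h : Fin d → ℤ) (y : Fin d → ℝ) : ‖cubeBasis h y‖ = 1 := by
  simp [cubeBasis, Complex.norm_exp]

theorem cubeBasis_eq_prod {d : ℕ} (h : Fin d → ℤ) (y : Fin d → ℝ) :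
    cubeBasis h y = ∏ j, Complex.exp (2 * Real.pi * Complex.I * h j * y j) := by
  rw [cubeBasis, ← Complex.exp_sum]
  congr 1
  push_cast
  rw [Finset.mul_sum]
  exact Finset.sum_congr rfl fun j _ => by ring

theorem cubeBasis_mul_conj {d : ℕ} (m h : Fin d → ℤ) (y : Fin d → ℝ) :
    cubeBasis m y * conj (cubeBasis h y) = cubeBasis (m - h) y := by
  unfold cubeBasis
  rw [← Complex.exp_conj, ← Complex.exp_add]
  congr 1
  simp only [map_mul, Complex.conj_I, Complex.conj_ofReal, map_ofNat, Pi.sub_apply, Int.cast_sub,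
    sub_mul, Finset.sum_sub_distrib, Complex.ofReal_sub]
  ring

theorem boxBasis_eq_mul_cubeBasis (a : ℝ) {d : ℕ} (h : Fin d → ℤ) (x : Fin d → ℝ) :
    boxBasis a h x = ((1 / Real.sqrt (2 * a) : ℝ) : ℂ) ^ d * cubeBasis h (scalingInv a x) := by
  rw [boxBasis, Finset.prod_mul_distrib, Finset.prod_const, Finset.card_univ, Fintype.card_fin,
    cubeBasis_eq_prod]
  rfl

theorem norm_boxBasis (a : ℝ) {d : ℕ} (h : Fin d → ℤ) (x : Fin d → ℝ) :
    ‖boxBasis a h x‖ = (1 / Real.sqrt (2 * a)) ^ d := by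
  rw [boxBasis_eq_mul_cubeBasis, norm_mul, norm_cubeBasis, mul_one, norm_pow, Complex.norm_real,
    Real.norm_of_nonneg (by positivity)]

theorem continuous_boxBasis (a : ℝ) {d : ℕ} (h : Fin d → ℤ) : Continuous (boxBasis a h) := by
  unfold boxBasis
  fun_prop

theorem integral_exp_two_pi_mul_I {a : ℝ} (ha : 0 < a) (n : ℤ) :
    ∫ x in Set.Icc (-a) a,
      Complex.exp (2 * Real.pi * Complex.I * n * (((x + a) / (2 * a) : ℝ) : ℂ)) =
      if n = 0 then 2 * (a : ℂ) else 0 := by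
  rw [integral_Icc_eq_integral_Ioc, ← intervalIntegral.integral_of_le (by linarith),
    intervalIntegral.integral_comp_add_right
      (fun x : ℝ => Complex.exp (2 * Real.pi * Complex.I * n * ((x / (2 * a) : ℝ) : ℂ))),
    intervalIntegral.integral_comp_div
      (fun x : ℝ => Complex.exp (2 * Real.pi * Complex.I * n * (x : ℂ))) (by positivity),
    neg_add_cancel, zero_div, ← two_mul, div_self (by positivity)]
  split_ifs with hn
  · simp [hn]
  · rw [integral_exp_mul_complex (mul_ne_zero Complex.two_pi_I_ne_zero (Int.cast_ne_zero.mpr hn)),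
      Complex.ofReal_one, mul_one, mul_comm (2 * _ * _) (n : ℂ), Complex.exp_int_mul_two_pi_mul_I]
    simp

theorem integral_cubeBasis_scalingInv {a : ℝ} (ha : 0 < a) {d : ℕ} (n : Fin d → ℤ) :
    ∫ x in box a d, cubeBasis n (scalingInv a x) = if n = 0 then (2 * (a : ℂ)) ^ d else 0 := by
  simp_rw [cubeBasis_eq_prod]
  rw [box, ← Set.pi_univ_Icc, volume_pi, Measure.restrict_pi_pi]
  refine (integral_fintype_prod_eq_prod (𝕜 := ℂ) fun j (t : ℝ) =>
    Complex.exp (2 * Real.pi * Complex.I * n j * (((t + a) / (2 * a) : ℝ) : ℂ))).trans ?_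
  simp_rw [integral_exp_two_pi_mul_I ha]
  split_ifs with hn
  · simp [hn]
  · obtain ⟨j, hj⟩ := Function.ne_iff.mp hn
    exact Finset.prod_eq_zero (Finset.mem_univ j) (if_neg hj)

theorem integral_boxBasis_mul_conj {a : ℝ} (ha : 0 < a) {d : ℕ} (h k : Fin d → ℤ) :
    ∫ x in box a d, boxBasis a h x * conj (boxBasis a k x) = if h = k then 1 else 0 := by
  have hmul (x : Fin d → ℝ) : boxBasis a h x * conj (boxBasis a k x) =
      (1 / (2 * (a : ℂ))) ^ d * cubeBasis (h - k) (scalingInv a x) := by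
    have hsqrt : 1 / Real.sqrt (2 * a) * (1 / Real.sqrt (2 * a)) = 1 / (2 * a) := by
      rw [div_mul_div_comm, one_mul, Real.mul_self_sqrt (by positivity)]
    rw [boxBasis_eq_mul_cubeBasis, boxBasis_eq_mul_cubeBasis, map_mul, map_pow,
      Complex.conj_ofReal, mul_mul_mul_comm, cubeBasis_mul_conj, ← mul_pow, ← Complex.ofReal_mul,
      hsqrt]
    push_cast
    rfl
  simp_rw [hmul]
  rw [integral_const_mul, integral_cubeBasis_scalingInv ha]
  simp only [sub_eq_zero]
  split_ifs
  · rw [← mul_pow, one_div_mul_cancel (mul_ne_zero two_ne_zero (Complex.ofReal_ne_zero.mpr ha.ne')),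
      one_pow]
  · exact mul_zero _

section Parseval

variable {X ι : Type*} {e : ι → X → ℂ} {C : ℝ} {c : ι → ℂ}

theorem norm_tsum_mul_le (he : ∀ i x, ‖e i x‖ ≤ C) (hc : Summable fun i => ‖c i‖) (x : X) :
    ‖∑' i, c i * e i x‖ ≤ (∑' i, ‖c i‖) * C := by
  rw [← tsum_mul_right]
  exact tsum_of_norm_bounded (hc.mul_right C).hasSum fun i => by
    rw [norm_mul]
    gcongr
    exact he i x

variable [TopologicalSpace X]

theorem continuous_tsum_mul (hcont : ∀ i, Continuous (e i)) (he : ∀ i x, ‖e i x‖ ≤ C)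
    (hc : Summable fun i => ‖c i‖) : Continuous fun x => ∑' i, c i * e i x :=
  continuous_tsum (fun i => continuous_const.mul (hcont i)) (hc.mul_right C) fun i x => by
    rw [norm_mul]
    gcongr
    exact he i x

variable [MeasurableSpace X] [OpensMeasurableSpace X] {μ : Measure X} [IsFiniteMeasure μ]
  [Countable ι]

theorem hasSum_mul_integral_mul (hcont : ∀ i, Continuous (e i))
    (he : ∀ i x, ‖e i x‖ ≤ C) (hc : Summable fun i => ‖c i‖) {g : X → ℂ} (hg : Continuous g)
    {D : ℝ} (hgD : ∀ x, ‖g x‖ ≤ D) :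
    HasSum (fun i => c i * ∫ x, e i x * g x ∂μ) (∫ x, (∑' i, c i * e i x) * g x ∂μ) := by
  have hbound (i : ι) (x : X) : ‖c i * (e i x * g x)‖ ≤ ‖c i‖ * (C * D) := by
    rw [norm_mul, norm_mul]
    gcongr
    exacts [(norm_nonneg _).trans (he i x), he i x, hgD x]
  have hint (i : ι) : Integrable (fun x => c i * (e i x * g x)) μ :=
    Integrable.of_bound (by fun_prop) _ (Filter.Eventually.of_forall (hbound i))
  have hsum := hasSum_integral_of_summable_integral_norm hint <|
    (hc.mul_right (C * D * μ.real Set.univ)).of_nonneg_of_le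
      (fun i => integral_nonneg fun x => norm_nonneg _) fun i => by
        refine (integral_mono (hint i).norm (integrable_const _) (hbound i)).trans_eq ?_
        rw [integral_const, smul_eq_mul]
        ring
  simp only [integral_const_mul] at hsum
  simpa only [← mul_assoc, tsum_mul_right] using hsum

variable [DecidableEq ι] (hcont : ∀ i, Continuous (e i)) (he : ∀ i x, ‖e i x‖ ≤ C)
  (horth : ∀ i j, ∫ x, e i x * conj (e j x) ∂μ = if i = j then 1 else 0)
  (hc : Summable fun i => ‖c i‖)

include hcont he horth hc

theorem integral_tsum_mul_mul_conj (j : ι) :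
    ∫ x, (∑' i, c i * e i x) * conj (e j x) ∂μ = c j := by
  have hsum := hasSum_mul_integral_mul (μ := μ) hcont he hc
    (Complex.continuous_conj.comp (hcont j)) (fun x => (RCLike.norm_conj _).trans_le (he j x))
  exact hsum.tsum_eq.symm.trans (by simp [horth])

theorem hasSum_norm_sq : HasSum (fun i => ‖c i‖ ^ 2) (∫ x, ‖∑' i, c i * e i x‖ ^ 2 ∂μ) := by
  have hsum := hasSum_mul_integral_mul (μ := μ) hcont he hc
    (Complex.continuous_conj.comp (continuous_tsum_mul hcont he hc))
    (fun x => (RCLike.norm_conj _).trans_le (norm_tsum_mul_le he hc x))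
  have hcoeff (i : ι) : ∫ x, e i x * conj (∑' k, c k * e k x) ∂μ = conj (c i) := by
    rw [← integral_tsum_mul_mul_conj hcont he horth hc i, ← integral_conj]
    simp only [map_mul, Complex.conj_conj, mul_comm]
  simp only [Function.comp_apply, hcoeff, Complex.mul_conj'] at hsum
  rw [← Complex.hasSum_ofReal, ← integral_complex_ofReal]
  simpa only [Complex.ofReal_pow] using hsum

theorem lintegral_enorm_tsum_sq :
    ∫⁻ x, ‖∑' i, c i * e i x‖ₑ ^ 2 ∂μ = ∑' i, ‖c i‖ₑ ^ 2 := by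
  have hparseval := hasSum_norm_sq hcont he horth hc
  have hint : Integrable (fun x => ‖∑' i, c i * e i x‖ ^ 2) μ :=
    Integrable.of_bound (((continuous_tsum_mul hcont he hc).norm.pow 2).aestronglyMeasurable)
      (((∑' i, ‖c i‖) * C) ^ 2) (Filter.Eventually.of_forall fun x => by
        rw [norm_pow, norm_norm]
        gcongr
        exact norm_tsum_mul_le he hc x)
  simp only [← ofReal_norm, ← ENNReal.ofReal_pow (norm_nonneg _)]
  rw [← ofReal_integral_eq_lintegral_ofReal hint (Filter.Eventually.of_forall fun x => sq_nonneg _),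
    ← hparseval.tsum_eq, ENNReal.ofReal_tsum_of_nonneg (fun _ => sq_nonneg _) hparseval.summable]

end Parseval

theorem lintegral_tsum_mul_boxBasis {a : ℝ} (ha : 0 < a) {d : ℕ} {c : (Fin d → ℤ) → ℂ}
    (hc : Summable fun h => ‖c h‖) :
    ∫⁻ x in box a d, ‖∑' h, c h * boxBasis a h x‖ₑ ^ 2 = ∑' h, ‖c h‖ₑ ^ 2 :=
  have : IsFiniteMeasure (volume.restrict (box a d)) :=
    isFiniteMeasure_restrict.mpr isCompact_Icc.measure_lt_top.ne
  lintegral_enorm_tsum_sq (continuous_boxBasis a) (fun h x => (norm_boxBasis a h x).le)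
    (integral_boxBasis_mul_conj ha) hc

/-! ### Aliasing -/

theorem cubeBasis_latticePoint {N : ℕ} {d : ℕ} (z : Fin d → ℕ) (n : Fin d → ℤ) (k : ℕ) :
    cubeBasis n (latticePoint N z k) =
      (Complex.exp (2 * Real.pi * Complex.I / N) ^ ∑ j, n j * (z j : ℤ)) ^ k := by
  rw [← Complex.exp_int_mul, ← Complex.exp_nat_mul, cubeBasis]
  refine Complex.exp_eq_exp_iff_exists_int.mpr
    ⟨-∑ j, n j * ⌊(k : ℝ) * (z j : ℝ) / (N : ℝ)⌋, ?_⟩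
  have hfract : ∑ j, (n j : ℝ) * latticePoint N z k j = k * (∑ j, n j * (z j : ℤ) : ℤ) / N -
      (∑ j, n j * ⌊(k : ℝ) * (z j : ℝ) / (N : ℝ)⌋ : ℤ) := by
    push_cast
    rw [Finset.mul_sum, Finset.sum_div, ← Finset.sum_sub_distrib]
    refine Finset.sum_congr rfl fun j _ => ?_
    rw [latticePoint, Int.fract]
    ring
  rw [hfract]
  push_cast
  ring

theorem sum_Icc_pow_of_pow_eq_one {F : Type*} [DivisionRing F] [DecidableEq F] {w : F} {N : ℕ}
    (hw : w ^ N = 1) : ∑ k ∈ Finset.Icc 1 N, w ^ k = if w = 1 then (N : F) else 0 := by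
  split_ifs with hw1
  · simp [hw1]
  · rw [← Finset.Ico_succ_right_eq_Icc, geom_sum_Ico hw1 (by simp)]
    simp [pow_succ, hw]

theorem sum_cubeBasis_latticePoint {N : ℕ} (hN : N ≠ 0) {d : ℕ} (z : Fin d → ℕ)
    (n : Fin d → ℤ) [Decidable (InDual N z n)] :
    ∑ k ∈ Finset.Icc 1 N, cubeBasis n (latticePoint N z k) =
      if InDual N z n then (N : ℂ) else 0 := by
  have hroot := Complex.isPrimitiveRoot_exp N hN
  simp_rw [cubeBasis_latticePoint]
  rw [sum_Icc_pow_of_pow_eq_one]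
  · simp only [hroot.zpow_eq_one_iff_dvd, InDual]
    congr
  · rw [← zpow_natCast, zpow_comm, zpow_natCast, hroot.pow_eq_one, one_zpow]

theorem scaling_latticePoint_mem_box (N : ℕ) {d : ℕ} (z : Fin d → ℕ) (k : ℕ) {a : ℝ}
    (ha : 0 ≤ a) : scaling a (latticePoint N z k) ∈ box a d := by
  refine ⟨fun j => ?_, fun j => ?_⟩
  · have := Int.fract_nonneg ((k : ℝ) * (z j : ℝ) / (N : ℝ))
    simp only [scaling, latticePoint]
    nlinarith
  · have := (Int.fract_lt_one ((k : ℝ) * (z j : ℝ) / (N : ℝ))).le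
    simp only [scaling, latticePoint]
    nlinarith

theorem scalingInv_scaling {a : ℝ} (ha : a ≠ 0) {d : ℕ} (y : Fin d → ℝ) :
    scalingInv a (scaling a y) = y := by
  funext j
  simp only [scaling, scalingInv]
  field_simp
  ring

theorem boxBasis_scaling_mul_conj {a : ℝ} (ha : a ≠ 0) {d : ℕ} (h l : Fin d → ℤ)
    (y : Fin d → ℝ) : boxBasis a (h + l) (scaling a y) * conj (cubeBasis h y) =
      ((1 / Real.sqrt (2 * a) : ℝ) : ℂ) ^ d * cubeBasis l y := by
  rw [boxBasis_eq_mul_cubeBasis, scalingInv_scaling ha, mul_assoc, cubeBasis_mul_conj,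
    add_sub_cancel_left]

theorem hasSum_latticeCoeff {N : ℕ} (hN : N ≠ 0) {a : ℝ} (ha : 0 < a) {d : ℕ} (z : Fin d → ℕ)
    {φ : (Fin d → ℝ) → ℂ} {c : (Fin d → ℤ) → ℂ}
    (hφ : ∀ x ∈ box a d, HasSum (fun h => c h * boxBasis a h x) (φ x)) (h : Fin d → ℤ) :
    HasSum ({l | InDual N z l}.indicator fun l =>
        c (h + l) * ((1 / Real.sqrt (2 * a) : ℝ) : ℂ) ^ d)
      (latticeCoeff N z (φ ∘ scaling a) h) := by
  classical
  have hpoint (k : ℕ) (_ : k ∈ Finset.Icc 1 N) : HasSum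
      (fun m => c m * boxBasis a m (scaling a (latticePoint N z k)) *
        conj (cubeBasis h (latticePoint N z k)))
      ((φ ∘ scaling a) (latticePoint N z k) * conj (cubeBasis h (latticePoint N z k))) :=
    (hφ _ (scaling_latticePoint_mem_box N z k ha.le)).mul_right _
  have hsum := (hasSum_sum hpoint).mul_left (1 / (N : ℂ))
  rw [← (Equiv.addLeft h).hasSum_iff] at hsum
  refine hsum.congr_fun fun l => ?_
  simp only [Function.comp_apply, Equiv.coe_addLeft, mul_assoc (c (h + l)),
    boxBasis_scaling_mul_conj ha.ne']
  rw [← Finset.mul_sum, ← Finset.mul_sum, sum_cubeBasis_latticePoint hN, Set.indicator_apply]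
  simp only [Set.mem_ofPred_eq]
  split_ifs
  · field_simp
  · simp

/-- The aliasing error of the lattice rule with generating vector `z` in the Fourier coefficient
with index `h`, for a function with Fourier coefficients `c`. -/
noncomputable def aliasCoeff (N : ℕ) {d : ℕ} (z : Fin d → ℕ) (c : (Fin d → ℤ) → ℂ)
    (h : Fin d → ℤ) : ℂ :=
  ∑' l : nonzeroDual N z, c (h + l)

theorem latticeCoeff_eq_add_aliasCoeff {N : ℕ} (hN : N ≠ 0) {a : ℝ} (ha : 0 < a) {d : ℕ}
    (z : Fin d → ℕ) {φ : (Fin d → ℝ) → ℂ} {c : (Fin d → ℤ) → ℂ}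
    (hφ : ∀ x ∈ box a d, HasSum (fun h => c h * boxBasis a h x) (φ x)) (h : Fin d → ℤ) :
    latticeCoeff N z (φ ∘ scaling a) h =
      (c h + aliasCoeff N z c h) * ((1 / Real.sqrt (2 * a) : ℝ) : ℂ) ^ d := by
  classical
  have hsum := hasSum_latticeCoeff hN ha z hφ h
  rw [← hsum.tsum_eq, hsum.summable.tsum_eq_add_tsum_ite 0, add_mul, aliasCoeff, ← tsum_mul_right,
    tsum_subtype (nonzeroDual N z) fun l => c (h + l) * ((1 / Real.sqrt (2 * a) : ℝ) : ℂ) ^ d]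
  congr 1
  · simp [InDual]
  · refine tsum_congr fun l => ?_
    by_cases hl : l = 0 <;> simp [hl, nonzeroDual, Set.indicator_apply]

/-! ### The error of the lattice algorithm -/

/-- The Fourier coefficients of the error of the lattice algorithm that truncates to the index set
`T`, for a function with Fourier coefficients `c`. -/
noncomputable def errorCoeff (N : ℕ) {d : ℕ} (z : Fin d → ℕ) (T : Set (Fin d → ℤ))
    (c : (Fin d → ℤ) → ℂ) (h : Fin d → ℤ) : ℂ :=
  open Classical in if h ∈ T then -aliasCoeff N z c h else c h

theorem summable_norm_errorCoeff (N : ℕ) {d : ℕ} (z : Fin d → ℕ) {c : (Fin d → ℤ) → ℂ}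
    (hc : Summable fun h => ‖c h‖) {T : Set (Fin d → ℤ)} (hT : T.Finite) :
    Summable fun h => ‖errorCoeff N z T c h‖ := by
  refine (summable_congr_cofinite ?_).mp hc
  filter_upwards [hT.compl_mem_cofinite] with h hh
  rw [errorCoeff, if_neg hh]

theorem scaledLatticeAlgorithm_eq (α : ℕ) {N : ℕ} (hN : N ≠ 0) {a : ℝ} (ha : 0 < a) {d : ℕ}
    (z : Fin d → ℕ) {φ : (Fin d → ℝ) → ℂ} {c : (Fin d → ℤ) → ℂ}
    (hφ : ∀ x ∈ box a d, HasSum (fun h => c h * boxBasis a h x) (φ x)) (x : Fin d → ℝ) :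
    scaledLatticeAlgorithm α a N z φ x =
      ∑ᶠ h ∈ truncationSet α (1 / Real.sqrt (latticeCriterion α N z)) d,
        (c h + aliasCoeff N z c h) * boxBasis a h x := by
  simp only [scaledLatticeAlgorithm, latticeAlgorithm, Function.comp_apply,
    latticeCoeff_eq_add_aliasCoeff hN ha z hφ, boxBasis_eq_mul_cubeBasis, mul_assoc]

theorem hasSum_errorCoeff {α : ℕ} (hα : 1 ≤ α) {N : ℕ} (hN : N ≠ 0) {a : ℝ} (ha : 0 < a) {d : ℕ}
    (z : Fin d → ℕ) {φ : (Fin d → ℝ) → ℂ} {c : (Fin d → ℤ) → ℂ}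
    (hφ : ∀ x ∈ box a d, HasSum (fun h => c h * boxBasis a h x) (φ x))
    {x : Fin d → ℝ} (hx : x ∈ box a d) :
    HasSum (fun h => errorCoeff N z
        (truncationSet α (1 / Real.sqrt (latticeCriterion α N z)) d) c h * boxBasis a h x)
      (φ x - scaledLatticeAlgorithm α a N z φ x) := by
  rw [scaledLatticeAlgorithm_eq α hN ha z hφ]
  have hT := truncationSet_finite α hα (1 / Real.sqrt (latticeCriterion α N z)) d
  set T := truncationSet α (1 / Real.sqrt (latticeCriterion α N z)) d
  have halg : HasSum (T.indicator fun h => (c h + aliasCoeff N z c h) * boxBasis a h x)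
      (∑ᶠ h ∈ T, (c h + aliasCoeff N z c h) * boxBasis a h x) := by
    rw [finsum_mem_eq_finite_toFinset_sum _ hT,
      ← Finset.sum_indicator_subset _ (Finset.Subset.refl hT.toFinset), hT.coe_toFinset]
    exact hasSum_sum_of_ne_finset_zero fun h hh => Set.indicator_of_notMem (by simpa using hh) _
  refine ((hφ x hx).sub halg).congr_fun fun h => ?_
  by_cases hh : h ∈ T
  · rw [errorCoeff, if_pos hh, Set.indicator_of_mem hh]
    ring
  · rw [errorCoeff, if_neg hh, Set.indicator_of_notMem hh, sub_zero]

/-- The squared norm in the Korobov space of smoothness `β / 2` on the unit cube of the function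
with Fourier coefficients `c`. -/
noncomputable def cubeNormSq (β : ℝ) {d : ℕ} (c : (Fin d → ℤ) → ℂ) : ℝ≥0∞ :=
  ∑' h, ‖c h‖ₑ ^ 2 / prodWeight β h

theorem enorm_aliasCoeff_sq_le (β : ℝ) (N : ℕ) {d : ℕ} (z : Fin d → ℕ) (c : (Fin d → ℤ) → ℂ)
    (h : Fin d → ℤ) : ‖aliasCoeff N z c h‖ₑ ^ 2 ≤
      (∑' l : nonzeroDual N z, prodWeight β (h + l.1)) * cubeNormSq β c := by
  refine (enorm_tsum_sq_le _ (fun l : nonzeroDual N z => prodWeight_ne_zero β (h + l.1))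
    fun l => prodWeight_ne_top β (h + l.1)).trans ?_
  gcongr
  exact ENNReal.tsum_comp_le_tsum_of_injective
    ((add_right_injective h).comp Subtype.val_injective) fun h => ‖c h‖ₑ ^ 2 / prodWeight β h

theorem mem_truncationSet_iff (α : ℕ) {M : ℝ} (hM : 0 ≤ M) {d : ℕ} (h : Fin d → ℤ) :
    h ∈ truncationSet α M d ↔ 1 ≤ ENNReal.ofReal M * prodWeight (2 * α) h := by
  rw [prodWeight_two_mul, ← ENNReal.ofReal_mul hM, ENNReal.one_le_ofReal, mul_one_div,
    one_le_div (pow_pos (cubeWeight_pos α h) 2)]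
  rfl

theorem enorm_errorCoeff_sq_le (α N : ℕ) {d : ℕ} (z : Fin d → ℕ) (c : (Fin d → ℤ) → ℂ)
    {M : ℝ} (hM : 0 ≤ M) (h : Fin d → ℤ) :
    ‖errorCoeff N z (truncationSet α M d) c h‖ₑ ^ 2 ≤
      (ENNReal.ofReal M)⁻¹ * (‖c h‖ₑ ^ 2 / prodWeight (2 * α) h) +
        ENNReal.ofReal M * (∑' l : nonzeroDual N z,
          prodWeight (2 * α) h * prodWeight (2 * α) (h + l.1)) * cubeNormSq (2 * α) c := by
  by_cases hh : h ∈ truncationSet α M d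
  · rw [errorCoeff, if_pos hh, enorm_neg, ENNReal.tsum_mul_left, ← mul_assoc]
    refine (enorm_aliasCoeff_sq_le (2 * α) N z c h).trans (le_add_left ?_)
    gcongr
    exact le_mul_of_one_le_left' ((mem_truncationSet_iff α hM h).mp hh)
  · rw [errorCoeff, if_neg hh]
    refine le_add_right ?_
    rw [mem_truncationSet_iff α hM, not_le] at hh
    rw [div_eq_mul_inv, mul_left_comm, ← ENNReal.mul_inv (.inr (prodWeight_ne_top _ h))
      (.inl ENNReal.ofReal_ne_top)]
    exact le_mul_of_one_le_right' (ENNReal.one_le_inv.mpr hh.le)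

theorem tsum_enorm_errorCoeff_sq_le (α N : ℕ) {d : ℕ} (z : Fin d → ℕ) (c : (Fin d → ℤ) → ℂ)
    {M : ℝ} (hM : 0 ≤ M) :
    ∑' h, ‖errorCoeff N z (truncationSet α M d) c h‖ₑ ^ 2 ≤
      ((ENNReal.ofReal M)⁻¹ + ENNReal.ofReal M * shiftSum (2 * α) (nonzeroDual N z)) *
        cubeNormSq (2 * α) c := by
  refine (ENNReal.tsum_le_tsum (enorm_errorCoeff_sq_le α N z c hM)).trans_eq ?_
  rw [ENNReal.tsum_add, ENNReal.tsum_mul_left, ENNReal.tsum_mul_right, ENNReal.tsum_mul_left,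
    ENNReal.tsum_comm, add_mul]
  rfl

theorem cubeWeight_le_boxWeight (α : ℕ) {a : ℝ} (ha : 1 / 2 ≤ a) {d : ℕ} (h : Fin d → ℤ) :
    cubeWeight α h ≤ (2 * a) ^ (α * d) * boxWeight α a h := by
  have ha0 : 0 < a := by linarith
  have hconst : (2 * a) ^ (α * d) = ∏ _j : Fin d, (2 * a) ^ α := by
    rw [Finset.prod_const, Finset.card_univ, Fintype.card_fin, pow_mul]
  rw [cubeWeight, boxWeight, hconst, ← Finset.prod_mul_distrib]
  refine Finset.prod_le_prod (fun j _ => by positivity) fun j _ => ?_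
  split_ifs
  · exact one_le_mul_of_one_le_of_one_le (one_le_pow₀ (by linarith))
      (Real.one_le_sqrt.mpr (by linarith))
  · rw [show 2 * Real.pi * (h j : ℝ) = 2 * a * (Real.pi * (h j : ℝ) / a) by field_simp, abs_mul,
      abs_of_pos (by linarith : 0 < 2 * a), mul_pow]

theorem korobovBoxNorm_nonneg (α : ℕ) (a : ℝ) {d : ℕ} (φ : (Fin d → ℝ) → ℂ) :
    0 ≤ korobovBoxNorm α a φ :=
  Real.sqrt_nonneg _

theorem MemKorobovBox.cubeNormSq_boxCoeff_le {α : ℕ} {a : ℝ} {d : ℕ} {φ : (Fin d → ℝ) → ℂ}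
    (hφ : MemKorobovBox α a φ) (ha : 1 / 2 ≤ a) :
    cubeNormSq (2 * α) (boxCoeff a φ) ≤
      ENNReal.ofReal ((korobovBoxNorm α a φ * (2 * a) ^ (α * d)) ^ 2) := by
  have hterm (h : Fin d → ℤ) : 0 ≤ ‖boxCoeff a φ h‖ ^ 2 * boxWeight α a h ^ 2 := by positivity
  rw [korobovBoxNorm, mul_pow, Real.sq_sqrt (tsum_nonneg hterm),
    ENNReal.ofReal_mul (tsum_nonneg hterm), ENNReal.ofReal_tsum_of_nonneg hterm hφ.2,
    ← ENNReal.tsum_mul_right]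
  refine ENNReal.tsum_le_tsum fun h => ?_
  have hpos := cubeWeight_pos α h
  rw [prodWeight_two_mul, ← ofReal_norm, ← ENNReal.ofReal_pow (norm_nonneg _),
    ← ENNReal.ofReal_div_of_pos (by positivity), ← ENNReal.ofReal_mul (hterm h), one_div,
    div_inv_eq_mul, mul_assoc, mul_comm (boxWeight α a h ^ 2),
    ← mul_pow ((2 * a) ^ (α * d))]
  gcongr
  exact cubeWeight_le_boxWeight α ha h

theorem MemKorobovBox.summable_norm_boxCoeff {α : ℕ} {a : ℝ} {d : ℕ} {φ : (Fin d → ℝ) → ℂ}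
    (hφ : MemKorobovBox α a φ) (ha : 0 < a) : Summable fun h : Fin d → ℤ => ‖boxCoeff a φ h‖ := by
  have hsum := (hφ.1 0 ⟨fun _ => neg_nonpos.mpr ha.le, fun _ => ha.le⟩).summable.norm
  simp_rw [norm_mul, norm_boxBasis] at hsum
  exact (summable_mul_right_iff (by positivity)).mp hsum

theorem MemKorobovBox.lintegral_enorm_sub_sq_le {α : ℕ} (hα : 1 ≤ α) {N : ℕ} (hN : 0 < N)
    {d : ℕ} (hd : 1 ≤ d) (z : Fin d → ℕ) {a : ℝ} (ha : 1 / 2 ≤ a) {φ : (Fin d → ℝ) → ℂ}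
    (hφ : MemKorobovBox α a φ) :
    ∫⁻ x in box a d, ‖φ x - scaledLatticeAlgorithm α a N z φ x‖ₑ ^ 2 ≤
      ENNReal.ofReal (2 * Real.sqrt (latticeCriterion α N z)) *
        ENNReal.ofReal ((korobovBoxNorm α a φ * (2 * a) ^ (α * d)) ^ 2) := by
  have ha0 : 0 < a := by linarith
  have hS : 0 < Real.sqrt (latticeCriterion α N z) :=
    Real.sqrt_pos.mpr (latticeCriterion_pos hα hN hd z)
  have hshift : shiftSum (2 * α) (nonzeroDual N z) = ENNReal.ofReal (latticeCriterion α N z) := by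
    rw [latticeCriterion_eq hα, ENNReal.ofReal_toReal (shiftSum_ne_top (one_lt_two_mul_cast hα) _)]
  calc _ = ∑' h, ‖errorCoeff N z (truncationSet α (1 / Real.sqrt (latticeCriterion α N z)) d)
        (boxCoeff a φ) h‖ₑ ^ 2 := by
        rw [← lintegral_tsum_mul_boxBasis ha0 (summable_norm_errorCoeff N z
          (hφ.summable_norm_boxCoeff ha0) (truncationSet_finite α hα _ d))]
        refine setLIntegral_congr_fun measurableSet_Icc fun x hx => ?_
        simp only [(hasSum_errorCoeff hα hN.ne' ha0 z hφ.1 hx).tsum_eq]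
    _ ≤ _ := tsum_enorm_errorCoeff_sq_le α N z _ (one_div_pos.mpr hS).le
    _ = ENNReal.ofReal (2 * Real.sqrt (latticeCriterion α N z)) *
        cubeNormSq (2 * α) (boxCoeff a φ) := by
        rw [hshift, ← ENNReal.ofReal_inv_of_pos (one_div_pos.mpr hS),
          ← ENNReal.ofReal_mul (one_div_pos.mpr hS).le,
          ← ENNReal.ofReal_add (inv_nonneg.mpr (one_div_pos.mpr hS).le)
            (mul_nonneg (one_div_pos.mpr hS).le (latticeCriterion_nonneg α N z)), inv_div, div_one,
          one_div_mul_eq_div, Real.div_sqrt, ← two_mul]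
    _ ≤ _ := by
        gcongr
        exact hφ.cubeNormSq_boxCoeff_le ha

theorem eLpNorm_two_sq {X : Type*} [MeasurableSpace X] (μ : Measure X) (f : X → ℂ) :
    eLpNorm f 2 μ ^ 2 = ∫⁻ x, ‖f x‖ₑ ^ 2 ∂μ := by
  have := eLpNorm_nnreal_pow_eq_lintegral (μ := μ) (f := f) (p := 2) two_ne_zero
  simpa using this

theorem MemKorobovBox.eLpNorm_sub_scaledLatticeAlgorithm_le {α : ℕ} (hα : 1 ≤ α) {N : ℕ}
    (hN : 0 < N) {d : ℕ} (hd : 1 ≤ d) (z : Fin d → ℕ) {a : ℝ} (ha : 1 / 2 ≤ a)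
    {φ : (Fin d → ℝ) → ℂ} (hφ : MemKorobovBox α a φ) :
    eLpNorm (fun x => φ x - scaledLatticeAlgorithm α a N z φ x) 2 (volume.restrict (box a d)) ≤
      ENNReal.ofReal (Real.sqrt 2 * latticeCriterion α N z ^ (1 / 4 : ℝ) *
        (korobovBoxNorm α a φ * (2 * a) ^ (α * d))) := by
  have : 0 ≤ a := by linarith
  have hnorm := korobovBoxNorm_nonneg α a φ
  have hS := latticeCriterion_nonneg α N z
  have hfourth : (latticeCriterion α N z ^ (1 / 4 : ℝ)) ^ 2 =
      Real.sqrt (latticeCriterion α N z) := by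
    rw [← Real.rpow_mul_natCast hS, Real.sqrt_eq_rpow]
    norm_num
  rw [← ENNReal.pow_le_pow_left_iff two_ne_zero, eLpNorm_two_sq]
  refine (hφ.lintegral_enorm_sub_sq_le hα hN hd z ha).trans_eq ?_
  rw [← ENNReal.ofReal_mul (by positivity), ← ENNReal.ofReal_pow (by positivity), mul_pow (_ * _),
    mul_pow (Real.sqrt 2), hfourth, Real.sq_sqrt zero_le_two]

end Korobov

theorem proposition3p4 (d α N : ℕ) (hd : 1 ≤ d) (hα : 1 ≤ α) (hN : N.Prime) :
    (∃ z : Fin d → ℕ, Korobov.IsCBC α N z) ∧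
    ∀ z : Fin d → ℕ, Korobov.IsCBC α N z →
      ∀ (a : ℝ), 1 / 2 ≤ a → ∀ (φ : (Fin d → ℝ) → ℂ), Korobov.MemKorobovBox α a φ →
        ∀ (δ : ℝ), 0 < δ → δ < (α : ℝ) / 2 →
          eLpNorm (fun x => φ x - Korobov.scaledLatticeAlgorithm α a N z φ x) 2
              (volume.restrict (Korobov.box a d)) ≤
            ENNReal.ofReal
              (Korobov.errorConst α (min δ ((α : ℝ) / 2 - 1 / 4)) d *
                Korobov.korobovBoxNorm α a φ * (2 * a) ^ (α * d) *
                (N : ℝ) ^ (-((α : ℝ) / 2) + δ)) := by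
  refine ⟨Korobov.exists_isCBC hα hN.two_le d, fun z hz a ha φ hφ δ hδ _ => ?_⟩
  refine (hφ.eLpNorm_sub_scaledLatticeAlgorithm_le hα hN.pos hd z ha).trans
    (ENNReal.ofReal_le_ofReal ?_)
  have hα' : (1 : ℝ) ≤ α := Nat.one_le_cast.mpr hα
  have hδ' : 0 < min δ ((α : ℝ) / 2 - 1 / 4) := lt_min hδ (by linarith)
  have hexp : (N : ℝ) ^ (-((α : ℝ) / 2) + min δ ((α : ℝ) / 2 - 1 / 4)) ≤
      (N : ℝ) ^ (-((α : ℝ) / 2) + δ) :=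
    Real.rpow_le_rpow_of_exponent_le (Nat.one_le_cast.mpr hN.one_le)
      (add_le_add le_rfl (min_le_left _ _))
  have hS := (hz.sqrt_two_mul_latticeCriterion_rpow_le hα hN hδ' (min_le_right _ _)).trans
    (mul_le_mul_of_nonneg_left hexp (Korobov.errorConst_nonneg α _ d))
  have hφ_nonneg : 0 ≤ Korobov.korobovBoxNorm α a φ * (2 * a) ^ (α * d) :=
    mul_nonneg (Korobov.korobovBoxNorm_nonneg α a φ) (pow_nonneg (by linarith) _)
  exact (mul_le_mul_of_nonneg_right hS hφ_nonneg).trans_eq (by ring)
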